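/- Let $Q$ and $K$ be finite groups. Let $\mathrm{Vec}_K$ be the monoidal category of finite-dimensional $K$-graded complex vector spaces with convolution product, with simple objects $\delta_k$ ($k\in K$). Let $\underline{\mathrm{Aut}}^{\otimes}(\mathrm{Vec}_K)$ be the 2-group of $\mathbb{C}$-linear monoidal autoequivalences of $\mathrm{Vec}_K$ and monoidal natural isomorphisms, and let $\underline{\mathrm{Aut}}^{\otimes}_0(\mathrm{Vec}_K)$ be its full sub-2-group of autoequivalences $F$ with $F(X)\cong X$ for all objects $X$. For a 2-group $\mathcal{A}$, $\mathrm{Hom}(Q,\mathcal{A})$ denotes the groupoid of monoidal functors $T\colon Q\to\mathcal{A}$ ($Q$ regarded as a discrete monoidal category) and monoidal natural transformations. Let $\varphi\colon Q\to\mathrm{Aut}(K)$ be a homomorphism, and let $T\in\mathrm{Hom}(Q,\underline{\mathrm{Aut}}^{\otimes}(\mathrm{Vec}_K))$ project to $\varphi$, i.e. $T_q(\delta_k)\cong\delta_{\varphi_q(k)}$ for all $q,k$. Given functions $\omega\colon Q\times K\times K\to\mathbb{C}^\times$ and $\eta\colon K\times Q\times Q\to\mathbb{C}^\times$, we say that $T$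 is given by $(\omega,\eta)$ if there are isomorphisms $\theta_{q,k}\colon T_q(\delta_k)\cong\delta_{\varphi_q(k)}$ under which the tensor structures $T_q(\delta_k)\otimes T_q(\delta_l)\to T_q(\delta_k\otimes\delta_l)\cong T_q(\delta_{kl})$ are the scalars $\omega(q,k,l)$ and the structure isomorphisms $T_q(T_{q'}(\delta_k))\to T_{qq'}(\delta_k)$ are the scalars $\eta(k,q,q')$. (1) Let $D(Q,K,\varphi)$ be the double group (double groupoid with one object) with vertical edges $Q$, horizontal edges $K$ and one square for each $(q,k)\in Q\times K$, with both vertical edges $q$, lower edge $k$ and upper edge $\varphi_q(k)$. Let $H^2(D(Q,K,\varphi))$ be its second cohomology with coefficients $\mathbb{C}^\times$, where $n$-cochains are families of functions on the composable $a\times b$ grids of squares with $a,b\ge 1$ and $a+b-1=n$. Then isomorphism classes of $T\in\mathrm{Hom}(Q,\underline{\mathrm{Aut}}^{\otimes}(\mathrm{Vec}_K))$ that project to $\varphi$ are in bijection with $H^2(D(Q,K,\varphi))$, in such a way that $T$ is given by $(\omega,\eta)$ if and only if $(\omega,\eta)$ is a 2-cocycle of $D(Q,K,\varphi)$ whose class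 corresponds to $T$. (2) (Here $\varphi$ is trivial.) Every $T\in\mathrm{Hom}(Q,\underline{\mathrm{Aut}}^{\otimes}_0(\mathrm{Vec}_K))$ is given by some pair $(\omega,\eta)$. A pair $(\omega,\eta)$ gives some such $T$ if and only if $$\partial_q\omega=\partial_k\eta,\qquad \partial_k\omega=0,\qquad \partial_q\eta=0,$$ where $\partial_q,\partial_k$ are the group cohomology differentials (trivial coefficients) in the variables from $Q$ and $K$. If $T$ and $T'$ are given by $(\omega,\eta)$ and $(\omega',\eta')$, then $T\cong T'$ if and only if there is $c\colon Q\times K\to\mathbb{C}^\times$ with $\omega'=\omega\cdot\partial_k c$ and $\eta'=\eta\cdot\partial_q c$. (3) There is an equivalence of groupoids $$\mathrm{Hom}(Q,\underline{\mathrm{Aut}}^{\otimes}_0(\mathrm{Vec}_K))\simeq\mathrm{Hom}(K,\underline{\mathrm{Aut}}^{\otimes}_0(\mathrm{Vec}_Q)),$$ in particular a bijection of isomorphism classes, such that $T$ is given by $(\omega,\eta)$ if and only if the corresponding action of $K$ on $\mathrm{Vec}_Q$ is given by $(\eta,\omega)$. -/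

import Mathlib

open CategoryTheory MonoidalCategory Functor.LaxMonoidal

universe u v w

namespace VecActions

/-! ### The tensor category of finite-dimensional `K`-graded complex vector spaces -/

section VecCat

/-- `Vec_K`: families `(V_k)_{k ∈ K}` of finite-dimensional complex vector spaces. -/
abbrev VecCat (K : Type u) : Type (max u 1) :=
  GradedObject (Additive K) (FGModuleCat.{0} ℂ)

open scoped Classical in
/-- Convolution: `(V ⊗ W)_n` is the direct sum of the `V_k ⊗ W_l` over `k * l = n`.
(`Additive K` only renames the multiplication of `K`; it need not be commutative.) -/
noncomputable instance VecCat.monoidal (K : Type u) [Group K] [Finite K] :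
    MonoidalCategory (VecCat K) :=
  GradedObject.monoidalCategory

/-- Morphisms are added degreewise. -/
noncomputable instance VecCat.preadditive (K : Type u) : Preadditive (VecCat K) where
  homGroup X Y := inferInstanceAs (AddCommGroup (∀ k, X k ⟶ Y k))
  add_comp _ _ _ f f' g := by
    funext k
    exact Preadditive.add_comp _ _ _ (f k) (f' k) (g k)
  comp_add _ _ _ f g g' := by
    funext k
    exact Preadditive.comp_add _ _ _ (f k) (g k) (g' k)

/-- Morphisms are multiplied by scalars degreewise. -/
noncomputable instance VecCat.linear (K : Type u) : Linear ℂ (VecCat K) where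
  homModule X Y := inferInstanceAs (Module ℂ (∀ k, X k ⟶ Y k))
  smul_comp _ _ _ r f g := by
    funext k
    exact Linear.smul_comp _ _ _ r (f k) (g k)
  comp_smul _ _ _ f r g := by
    funext k
    exact Linear.comp_smul _ _ _ (f k) r (g k)

open scoped Classical in
/-- The simple object `δ_k`: the line `ℂ` placed in degree `k`. -/
noncomputable def delta {K : Type u} (k : K) : VecCat K :=
  (GradedObject.single (Additive.ofMul k)).obj (𝟙_ (FGModuleCat.{0} ℂ))

open scoped Classical in
/-- The identification of the degree `k` part of `δ_k` with `ℂ`. -/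
noncomputable def deltaIso {K : Type u} (k : K) (i : Additive K) (h : i = Additive.ofMul k) :
    delta k i ≅ 𝟙_ (FGModuleCat.{0} ℂ) :=
  GradedObject.singleObjApplyIsoOfEq (Additive.ofMul k) (𝟙_ (FGModuleCat.{0} ℂ)) i h

open scoped Classical in
/-- The canonical morphism (an isomorphism) `δ_k ⊗ δ_l ⟶ δ_{kl}`, which in degree `kl` is the
multiplication `ℂ ⊗ ℂ ⟶ ℂ`. -/
noncomputable def deltaMul {K : Type u} [Group K] [Finite K] (k l : K) :
    delta k ⊗ delta l ⟶ delta (k * l) :=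
  fun n => GradedObject.Monoidal.tensorObjDesc fun i j hij =>
    if h : i = Additive.ofMul k ∧ j = Additive.ofMul l then
      ((deltaIso k i h.1).hom ⊗ₘ (deltaIso l j h.2).hom) ≫
        (λ_ (𝟙_ (FGModuleCat.{0} ℂ))).hom ≫
          (deltaIso (k * l) n (by rw [← hij, h.1, h.2]; rfl)).inv
    else 0

end VecCat

/-! ### The 2-group of tensor autoequivalences and its homomorphisms from a group -/

section TensorAut

/-- A `ℂ`-linear monoidal autoequivalence of a `ℂ`-linear monoidal category. -/
structure TensorAut (C : Type u) [Category.{v} C] [MonoidalCategory C] [Preadditive C]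
    [Linear ℂ C] where
  functor : C ⥤ C
  monoidal : functor.Monoidal
  isEquivalence : functor.IsEquivalence
  additive : functor.Additive
  linear : functor.Linear ℂ

attribute [instance] TensorAut.monoidal TensorAut.isEquivalence TensorAut.additive
  TensorAut.linear

variable {C : Type u} [Category.{v} C] [MonoidalCategory C] [Preadditive C] [Linear ℂ C]

/-- A morphism of tensor autoequivalences is a monoidal natural isomorphism. -/
@[ext]
structure TensorAut.Hom (F G : TensorAut C) where
  iso : F.functor ≅ G.functor
  isMonoidal : NatTrans.IsMonoidal iso.hom

attribute [instance] TensorAut.Hom.isMonoidal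

instance TensorAut.groupoid : Groupoid (TensorAut C) where
  Hom F G := TensorAut.Hom F G
  id F := ⟨Iso.refl _, inferInstanceAs (NatTrans.IsMonoidal (𝟙 F.functor))⟩
  comp α β := ⟨α.iso ≪≫ β.iso,
    inferInstanceAs (NatTrans.IsMonoidal (α.iso.hom ≫ β.iso.hom))⟩
  inv α := ⟨α.iso.symm, inferInstanceAs (NatTrans.IsMonoidal α.iso.inv)⟩
  id_comp _ := TensorAut.Hom.ext (Iso.refl_trans _)
  comp_id _ := TensorAut.Hom.ext (Iso.trans_refl _)
  assoc _ _ _ := TensorAut.Hom.ext (Iso.trans_assoc _ _ _)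
  inv_comp α := TensorAut.Hom.ext α.iso.symm_self_id
  comp_inv α := TensorAut.Hom.ext α.iso.self_symm_id

@[ext]
lemma TensorAut.hom_ext {F G : TensorAut C} {α β : F ⟶ G}
    (h : ∀ X, α.iso.hom.app X = β.iso.hom.app X) : α = β :=
  TensorAut.Hom.ext (Iso.ext (NatTrans.ext (funext h)))

@[simp]
lemma TensorAut.id_iso_hom_app (F : TensorAut C) (X : C) :
    (TensorAut.Hom.iso (𝟙 F)).hom.app X = 𝟙 _ := rfl

@[simp]
lemma TensorAut.comp_iso_hom_app {F G H : TensorAut C} (α : F ⟶ G) (β : G ⟶ H) (X : C) :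
    (TensorAut.Hom.iso (α ≫ β)).hom.app X = α.iso.hom.app X ≫ β.iso.hom.app X := rfl

/-- The tensor product of autoequivalences is `F ⊗ G = F ∘ G` (first `G`, then `F`), that of
monoidal natural isomorphisms is the horizontal composite. -/
instance TensorAut.monoidalStruct : MonoidalCategoryStruct (TensorAut C) where
  tensorObj F G :=
    { functor := G.functor ⋙ F.functor
      monoidal := inferInstance
      isEquivalence := inferInstance
      additive := inferInstance
      linear := inferInstance }
  tensorUnit :=
    { functor := 𝟭 C
      monoidal := inferInstance
      isEquivalence := inferInstance
      additive := inferInstance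
      linear := inferInstance }
  whiskerLeft F _ _ β := ⟨Functor.isoWhiskerRight β.iso F.functor,
    inferInstanceAs (NatTrans.IsMonoidal (Functor.whiskerRight β.iso.hom F.functor))⟩
  whiskerRight α G := ⟨Functor.isoWhiskerLeft G.functor α.iso,
    inferInstanceAs (NatTrans.IsMonoidal (Functor.whiskerLeft G.functor α.iso.hom))⟩
  associator F G H := (Groupoid.isoEquivHom _ _).symm
    ⟨(Functor.associator H.functor G.functor F.functor).symm,
      inferInstanceAs (NatTrans.IsMonoidal
        (Functor.associator H.functor G.functor F.functor).inv)⟩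
  leftUnitor F := (Groupoid.isoEquivHom _ _).symm
    ⟨Functor.rightUnitor F.functor,
      inferInstanceAs (NatTrans.IsMonoidal (Functor.rightUnitor F.functor).hom)⟩
  rightUnitor F := (Groupoid.isoEquivHom _ _).symm
    ⟨Functor.leftUnitor F.functor,
      inferInstanceAs (NatTrans.IsMonoidal (Functor.leftUnitor F.functor).hom)⟩

@[simp]
lemma TensorAut.tensorObj_functor (F G : TensorAut C) :
    (F ⊗ G).functor = G.functor ⋙ F.functor := rfl

@[simp]
lemma TensorAut.tensorUnit_functor : (𝟙_ (TensorAut C)).functor = 𝟭 C := rfl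

@[simp]
lemma TensorAut.whiskerLeft_app (F : TensorAut C) {G G' : TensorAut C} (β : G ⟶ G') (X : C) :
    (TensorAut.Hom.iso (F ◁ β)).hom.app X = F.functor.map (β.iso.hom.app X) := rfl

@[simp]
lemma TensorAut.whiskerRight_app {F F' : TensorAut C} (α : F ⟶ F') (G : TensorAut C) (X : C) :
    (TensorAut.Hom.iso (α ▷ G)).hom.app X = α.iso.hom.app (G.functor.obj X) := rfl

@[simp]
lemma TensorAut.tensorHom_app {F F' G G' : TensorAut C} (α : F ⟶ F') (β : G ⟶ G') (X : C) :
    (TensorAut.Hom.iso (α ⊗ₘ β)).hom.app X =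
      α.iso.hom.app (G.functor.obj X) ≫ F'.functor.map (β.iso.hom.app X) := rfl

@[simp]
lemma TensorAut.associator_hom_app (F G H : TensorAut C) (X : C) :
    (TensorAut.Hom.iso (α_ F G H).hom).hom.app X = 𝟙 _ := rfl

@[simp]
lemma TensorAut.leftUnitor_hom_app (F : TensorAut C) (X : C) :
    (TensorAut.Hom.iso (λ_ F).hom).hom.app X = 𝟙 _ := rfl

@[simp]
lemma TensorAut.rightUnitor_hom_app (F : TensorAut C) (X : C) :
    (TensorAut.Hom.iso (ρ_ F).hom).hom.app X = 𝟙 _ := rfl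

instance TensorAut.monoidalCategory : MonoidalCategory (TensorAut C) where
  tensorHom_def _ _ := rfl
  id_tensorHom_id _ _ := by ext; simp
  tensorHom_comp_tensorHom _ _ _ _ := by ext; simp
  whiskerLeft_id _ _ := by ext; simp
  id_whiskerRight _ _ := by ext; simp
  associator_naturality _ _ _ := by ext; simp
  leftUnitor_naturality _ := by ext; simp
  rightUnitor_naturality _ := by ext; simp
  pentagon _ _ _ _ := by ext; simp
  triangle _ _ := by ext; simp

/-- The tensor structure `F X ⊗ F Y ⟶ F (X ⊗ Y)` of a tensor autoequivalence. -/
abbrev TensorAut.tensorMap (F : TensorAut C) (X Y : C) :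
    F.functor.obj X ⊗ F.functor.obj Y ⟶ F.functor.obj (X ⊗ Y) :=
  μ F.functor X Y

variable (C) in
/-- The autoequivalences that preserve the isomorphism class of every object. -/
def fixesIsoClasses : ObjectProperty (TensorAut C) :=
  fun F => ∀ X : C, Nonempty (F.functor.obj X ≅ X)

instance fixesIsoClasses_isMonoidal : (fixesIsoClasses C).IsMonoidal where
  prop_unit X := ⟨Iso.refl X⟩
  prop_tensor F G hF hG X := by
    obtain ⟨a⟩ := hG X
    obtain ⟨b⟩ := hF X
    exact ⟨F.functor.mapIso a ≪≫ b⟩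

variable (C) in
/-- The full sub-2-group of the autoequivalences that preserve isomorphism classes. -/
abbrev TensorAut₀ := (fixesIsoClasses C).FullSubcategory

variable (Q : Type w) [Group Q]

variable (C) in
/-- The groupoid of actions of the group `Q` on `C` by tensor autoequivalences: monoidal functors
from the discrete monoidal category `Q` to `TensorAut C`, with monoidal natural transformations
as morphisms. As `TensorAut C` is a groupoid, the structure maps `T_q ∘ T_{q'} ⟶ T_{qq'}` and
`𝟭 ⟶ T_1` are isomorphisms, so a lax monoidal functor is the same as a strong one. -/
abbrev TensorAction := LaxMonoidalFunctor (Discrete Q) (TensorAut C)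

variable (C) in
/-- The groupoid of actions of `Q` on `C` by tensor autoequivalences that preserve isomorphism
classes. -/
abbrev TensorAction₀ := LaxMonoidalFunctor (Discrete Q) (TensorAut₀ C)

variable {Q}

/-- Forget that the autoequivalences preserve isomorphism classes. -/
def TensorAction₀.toTensorAction (T : TensorAction₀ C Q) : TensorAction C Q :=
  LaxMonoidalFunctor.of (T.toFunctor ⋙ (fixesIsoClasses C).ι)

/-- The tensor autoequivalence `T_q` by which `q` acts. -/
abbrev TensorAction.act (T : TensorAction C Q) (q : Q) : TensorAut C :=
  T.obj (Discrete.mk q)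

/-- The structure isomorphism `T_q (T_{q'} X) ⟶ T_{qq'} X`. -/
abbrev TensorAction.actMul (T : TensorAction C Q) (q q' : Q) (X : C) :
    (T.act q).functor.obj ((T.act q').functor.obj X) ⟶ (T.act (q * q')).functor.obj X :=
  (TensorAut.Hom.iso (μ T.toFunctor (Discrete.mk q) (Discrete.mk q'))).hom.app X

end TensorAut

/-! ### Actions on `Vec_K` in terms of scalars -/

section Scalars

variable {K : Type u} {Q : Type v} [Group K] [Finite K] [Group Q]

/-- The action `T` of `Q` on `Vec_K` projects to `φ : Q → Aut K`: the autoequivalence `T_q`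
permutes the isomorphism classes of simple objects by `φ q`. -/
def projectsTo (φ : Q →* MulAut K) : ObjectProperty (TensorAction (VecCat K) Q) :=
  fun T => ∀ q k, Nonempty ((T.act q).functor.obj (delta k) ≅ delta (φ q k))

/-- The groupoid of actions of `Q` on `Vec_K` that project to `φ`. -/
abbrev ActionOver (φ : Q →* MulAut K) := (projectsTo φ).FullSubcategory

/-- With respect to isomorphisms `θ q k : T_q δ_k ≅ δ_{φ_q k}`, the tensor structures
`T_q δ_k ⊗ T_q δ_l ⟶ T_q (δ_k ⊗ δ_l)` are the scalars `ω q k l`, and the structure isomorphisms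
`T_q (T_{q'} δ_k) ⟶ T_{qq'} δ_k` are the scalars `η k q q'`. -/
structure HasScalars (φ : Q →* MulAut K) (T : TensorAction (VecCat K) Q)
    (θ : ∀ q k, (T.act q).functor.obj (delta k) ≅ delta (φ q k))
    (ω : Q → K → K → ℂˣ) (η : K → Q → Q → ℂˣ) : Prop where
  tensor (q : Q) (k l : K) :
    (T.act q).tensorMap (delta k) (delta l) ≫
        (T.act q).functor.map (deltaMul k l) ≫ (θ q (k * l)).hom =
      (ω q k l : ℂ) • (((θ q k).hom ⊗ₘ (θ q l).hom) ≫ deltaMul (φ q k) (φ q l) ≫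
        eqToHom (congrArg delta (map_mul (φ q) k l).symm))
  mul (q q' : Q) (k : K) :
    T.actMul q q' (delta k) ≫ (θ (q * q') k).hom =
      (η k q q' : ℂ) • ((T.act q).functor.map (θ q' k).hom ≫ (θ q (φ q' k)).hom ≫
        eqToHom (congrArg delta
          (show φ q (φ q' k) = φ (q * q') k by rw [map_mul, MulAut.mul_apply])))

/-- The action `T` over `φ` is given by the pair `(ω, η)`, for some choice of isomorphisms
`T_q δ_k ≅ δ_{φ_q k}`. -/
def IsGivenBy (φ : Q →* MulAut K) (T : TensorAction (VecCat K) Q)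
    (ω : Q → K → K → ℂˣ) (η : K → Q → Q → ℂˣ) : Prop :=
  ∃ θ : ∀ q k, (T.act q).functor.obj (delta k) ≅ delta (φ q k), HasScalars φ T θ ω η

/-- The action `T` that preserves isomorphism classes is given by the pair `(ω, η)`, for some
choice of isomorphisms `T_q δ_k ≅ δ_k`. -/
def IsGivenBy₀ (T : TensorAction₀ (VecCat K) Q)
    (ω : Q → K → K → ℂˣ) (η : K → Q → Q → ℂˣ) : Prop :=
  IsGivenBy 1 T.toTensorAction ω η

end Scalars

/-! ### Group cohomology differentials with trivial coefficients -/

section Differentials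

variable {G : Type u} [Group G] {A : Type v} [CommGroup A]

/-- The differential of a 1-cochain of `G` (trivial action on the coefficients). -/
def d₁ (f : G → A) (a b : G) : A := f b * (f (a * b))⁻¹ * f a

/-- The differential of a 2-cochain of `G` (trivial action on the coefficients). -/
def d₂ (f : G → G → A) (a b c : G) : A :=
  f b c * (f (a * b) c)⁻¹ * f a (b * c) * (f a b)⁻¹

/-- The conditions `∂_q ω = ∂_k η`, `∂_k ω = 0` and `∂_q η = 0`, written multiplicatively. -/
structure IsCocyclePair {Q : Type u} {K : Type v} [Group Q] [Group K]
    (ω : Q → K → K → ℂˣ) (η : K → Q → Q → ℂˣ) : Prop where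
  mixed (q q' : Q) (k k' : K) :
    d₁ (fun x => ω x k k') q q' = d₁ (fun y => η y q q') k k'
  dk (q : Q) (k k' k'' : K) : d₂ (ω q) k k' k'' = 1
  dq (k : K) (q q' q'' : Q) : d₂ (η k) q q' q'' = 1

end Differentials

/-! ### Double groups and their second cohomology -/

section DoubleGroup

/-- A double group: a double groupoid with one object. It has a group `H` of horizontal edges, a
group `V` of vertical edges, and a set `S` of squares
```
      top
   o ----- o
left |  s  | right
   o ----- o
      bot
```
that compose horizontally along vertical edges and vertically along horizontal edges. -/
structure DoubleGroup (H : Type u) (V : Type v) (S : Type w) [Group H] [Group V] where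
  top : S → H
  bot : S → H
  left : S → V
  right : S → V
  hcomp (s t : S) (h : right s = left t) : S
  vcomp (s t : S) (h : bot s = top t) : S
  hid : V → S
  vid : H → S
  hinv : S → S
  vinv : S → S
  left_hcomp (s t h) : left (hcomp s t h) = left s
  right_hcomp (s t h) : right (hcomp s t h) = right t
  top_hcomp (s t h) : top (hcomp s t h) = top s * top t
  bot_hcomp (s t h) : bot (hcomp s t h) = bot s * bot t
  top_vcomp (s t h) : top (vcomp s t h) = top s
  bot_vcomp (s t h) : bot (vcomp s t h) = bot t
  left_vcomp (s t h) : left (vcomp s t h) = left s * left t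
  right_vcomp (s t h) : right (vcomp s t h) = right s * right t
  left_hid (a) : left (hid a) = a
  right_hid (a) : right (hid a) = a
  top_hid (a) : top (hid a) = 1
  bot_hid (a) : bot (hid a) = 1
  top_vid (b) : top (vid b) = b
  bot_vid (b) : bot (vid b) = b
  left_vid (b) : left (vid b) = 1
  right_vid (b) : right (vid b) = 1
  left_hinv (s) : left (hinv s) = right s
  right_hinv (s) : right (hinv s) = left s
  top_vinv (s) : top (vinv s) = bot s
  bot_vinv (s) : bot (vinv s) = top s
  hcomp_assoc (s t u : S) (h : right s = left t) (h' : right t = left u) :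
    hcomp (hcomp s t h) u ((right_hcomp s t h).trans h') =
      hcomp s (hcomp t u h') (h.trans (left_hcomp t u h').symm)
  vcomp_assoc (s t u : S) (h : bot s = top t) (h' : bot t = top u) :
    vcomp (vcomp s t h) u ((bot_vcomp s t h).trans h') =
      vcomp s (vcomp t u h') (h.trans (top_vcomp t u h').symm)
  hid_hcomp (s) : hcomp (hid (left s)) s (right_hid _) = s
  hcomp_hid (s) : hcomp s (hid (right s)) (left_hid _).symm = s
  vid_vcomp (s) : vcomp (vid (top s)) s (bot_vid _) = s
  vcomp_vid (s) : vcomp s (vid (bot s)) (top_vid _).symm = s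
  hinv_hcomp (s) : hcomp (hinv s) s (right_hinv s) = hid (right s)
  hcomp_hinv (s) : hcomp s (hinv s) (left_hinv s).symm = hid (left s)
  vinv_vcomp (s) : vcomp (vinv s) s (bot_vinv s) = vid (bot s)
  vcomp_vinv (s) : vcomp s (vinv s) (top_vinv s).symm = vid (top s)
  hid_mul (a b) : hid (a * b) = vcomp (hid a) (hid b) ((bot_hid a).trans (top_hid b).symm)
  vid_mul (a b) : vid (a * b) = hcomp (vid a) (vid b) ((right_vid a).trans (left_vid b).symm)
  hid_one : hid 1 = vid 1
  interchange (s t u v : S) (hst : right s = left t) (huv : right u = left v)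
      (hsu : bot s = top u) (htv : bot t = top v) :
    vcomp (hcomp s t hst) (hcomp u v huv)
        (by rw [bot_hcomp, top_hcomp, hsu, htv]) =
      hcomp (vcomp s u hsu) (vcomp t v htv)
        (by rw [right_vcomp, left_vcomp, hst, huv])

namespace DoubleGroup

variable {H : Type u} {V : Type v} {S : Type w} [Group H] [Group V]

/-- Pairs of horizontally composable squares. -/
abbrev HPair (D : DoubleGroup H V S) := {p : S × S // D.right p.1 = D.left p.2}

/-- Pairs of vertically composable squares. -/
abbrev VPair (D : DoubleGroup H V S) := {p : S × S // D.bot p.1 = D.top p.2}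

/-- Triples of horizontally composable squares. -/
abbrev HTriple (D : DoubleGroup H V S) :=
  {p : S × S × S // D.right p.1 = D.left p.2.1 ∧ D.right p.2.1 = D.left p.2.2}

/-- Triples of vertically composable squares. -/
abbrev VTriple (D : DoubleGroup H V S) :=
  {p : S × S × S // D.bot p.1 = D.top p.2.1 ∧ D.bot p.2.1 = D.top p.2.2}

/-- Composable `2 × 2` grids, with first row `p.1` and second row `p.2`. -/
abbrev Grid (D : DoubleGroup H V S) :=
  {p : (S × S) × (S × S) //
    (D.right p.1.1 = D.left p.1.2 ∧ D.right p.2.1 = D.left p.2.2) ∧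
      (D.bot p.1.1 = D.top p.2.1 ∧ D.bot p.1.2 = D.top p.2.2)}

variable (D : DoubleGroup H V S) (A : Type*) [CommGroup A]

/-- The cochains of a double group are the functions on the composable `m × n` grids of squares
with `m, n ≥ 1`; such a grid has degree `m + n - 1`. -/
abbrev C1 (_ : DoubleGroup H V S) (A : Type*) := S → A

/-- Cochains of degree 2. -/
abbrev C2 := (D.HPair → A) × (D.VPair → A)

/-- Cochains of degree 3. -/
abbrev C3 := (D.HTriple → A) × (D.Grid → A) × (D.VTriple → A)

/-- The differential in degree 1. -/
def diff1 : D.C1 A →* D.C2 A where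
  toFun c :=
    (fun p => c p.1.2 / c (D.hcomp p.1.1 p.1.2 p.2) * c p.1.1,
      fun p => c p.1.2 / c (D.vcomp p.1.1 p.1.2 p.2) * c p.1.1)
  map_one' := by ext <;> simp
  map_mul' a b := by
    ext p <;> simp only [Pi.mul_apply, Prod.mk_mul_mk] <;>
      rw [mul_div_mul_comm, mul_mul_mul_comm]

/-- The component of the differential on horizontal triples. -/
def diff2H : (D.HPair → A) →* (D.HTriple → A) where
  toFun f p :=
    f ⟨(p.1.2.1, p.1.2.2), p.2.2⟩ /
        f ⟨(D.hcomp p.1.1 p.1.2.1 p.2.1, p.1.2.2), (D.right_hcomp _ _ _).trans p.2.2⟩ *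
      f ⟨(p.1.1, D.hcomp p.1.2.1 p.1.2.2 p.2.2), p.2.1.trans (D.left_hcomp _ _ _).symm⟩ /
        f ⟨(p.1.1, p.1.2.1), p.2.1⟩
  map_one' := by ext; simp
  map_mul' a b := by
    ext p
    simp only [Pi.mul_apply, div_eq_mul_inv, mul_inv]
    ac_rfl

/-- The component of the differential on vertical triples. -/
def diff2V : (D.VPair → A) →* (D.VTriple → A) where
  toFun f p :=
    f ⟨(p.1.2.1, p.1.2.2), p.2.2⟩ /
        f ⟨(D.vcomp p.1.1 p.1.2.1 p.2.1, p.1.2.2), (D.bot_vcomp _ _ _).trans p.2.2⟩ *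
      f ⟨(p.1.1, D.vcomp p.1.2.1 p.1.2.2 p.2.2), p.2.1.trans (D.top_vcomp _ _ _).symm⟩ /
        f ⟨(p.1.1, p.1.2.1), p.2.1⟩
  map_one' := by ext; simp
  map_mul' a b := by
    ext p
    simp only [Pi.mul_apply, div_eq_mul_inv, mul_inv]
    ac_rfl

/-- The vertical differential of a function of horizontal pairs. -/
def gridV : (D.HPair → A) →* (D.Grid → A) where
  toFun f p :=
    f ⟨p.1.2, p.2.1.2⟩ /
        f ⟨(D.vcomp p.1.1.1 p.1.2.1 p.2.2.1, D.vcomp p.1.1.2 p.1.2.2 p.2.2.2), by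
          rw [D.right_vcomp, D.left_vcomp, p.2.1.1, p.2.1.2]⟩ *
      f ⟨p.1.1, p.2.1.1⟩
  map_one' := by ext; simp
  map_mul' a b := by
    ext p
    simp only [Pi.mul_apply]
    rw [mul_div_mul_comm, mul_mul_mul_comm]

/-- The horizontal differential of a function of vertical pairs. -/
def gridH : (D.VPair → A) →* (D.Grid → A) where
  toFun f p :=
    f ⟨(p.1.1.2, p.1.2.2), p.2.2.2⟩ /
        f ⟨(D.hcomp p.1.1.1 p.1.1.2 p.2.1.1, D.hcomp p.1.2.1 p.1.2.2 p.2.1.2), by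
          rw [D.bot_hcomp, D.top_hcomp, p.2.2.1, p.2.2.2]⟩ *
      f ⟨(p.1.1.1, p.1.2.1), p.2.2.1⟩
  map_one' := by ext; simp
  map_mul' a b := by
    ext p
    simp only [Pi.mul_apply]
    rw [mul_div_mul_comm, mul_mul_mul_comm]

/-- The differential in degree 2. -/
def diff2 : D.C2 A →* D.C3 A :=
  MonoidHom.prod ((diff2H D A).comp (MonoidHom.fst _ _))
    (MonoidHom.prod
      ((gridV D A).comp (MonoidHom.fst _ _) / (gridH D A).comp (MonoidHom.snd _ _))
      ((diff2V D A).comp (MonoidHom.snd _ _)))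

/-- The cochains form a complex. -/
lemma diff2_diff1 (c : D.C1 A) : diff2 D A (diff1 D A c) = 1 := by
  have key : ∀ (B : Type _) [AddCommGroup B] (x y z xy yz xyz : B),
      (z - yz + y) - (z - xyz + xy) + (yz - xyz + x) - (y - xy + x) = 0 := by
    intros
    abel
  have key' : ∀ (B : Type _) [AddCommGroup B] (s t u v st uv su tv m : B),
      (v - uv + u) - (tv - m + su) + (t - st + s) -
        ((v - tv + t) - (uv - m + st) + (u - su + s)) = 0 := by
    intros
    abel
  refine Prod.ext ?_ (Prod.ext ?_ ?_)
  · funext ⟨⟨s, t, u⟩, h, h'⟩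
    have := key (Additive A) (c s) (c t) (c u) (c (D.hcomp s t h)) (c (D.hcomp t u h'))
      (c (D.hcomp s (D.hcomp t u h') (h.trans (D.left_hcomp t u h').symm)))
    nth_rewrite 1 [← D.hcomp_assoc s t u h h'] at this
    exact this
  · funext ⟨⟨⟨s, t⟩, u, v⟩, ⟨hst, huv⟩, hsu, htv⟩
    have := key' (Additive A) (c s) (c t) (c u) (c v) (c (D.hcomp s t hst))
      (c (D.hcomp u v huv)) (c (D.vcomp s u hsu)) (c (D.vcomp t v htv))
      (c (D.vcomp (D.hcomp s t hst) (D.hcomp u v huv)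
        (by rw [D.bot_hcomp, D.top_hcomp, hsu, htv])))
    nth_rewrite 1 [D.interchange s t u v hst huv hsu htv] at this
    exact this
  · funext ⟨⟨s, t, u⟩, h, h'⟩
    have := key (Additive A) (c s) (c t) (c u) (c (D.vcomp s t h)) (c (D.vcomp t u h'))
      (c (D.vcomp s (D.vcomp t u h') (h.trans (D.top_vcomp t u h').symm)))
    nth_rewrite 1 [← D.vcomp_assoc s t u h h'] at this
    exact this

/-- Cocycles of degree 2. -/
abbrev Z2 : Subgroup (D.C2 A) := (diff2 D A).ker

/-- Coboundaries of degree 2, as a subgroup of the cocycles. -/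
abbrev B2 : Subgroup (Z2 D A) := (diff1 D A).range.subgroupOf (Z2 D A)

/-- The second cohomology group of a double group with coefficients in `A`. -/
abbrev H2 := Z2 D A ⧸ B2 D A

/-- The double group `D(Q, K, φ)` of an action `φ` of `Q` on `K`: there is one square for each
`(q, k)`, with both vertical edges `q`, lower edge `k` and upper edge `φ_q k`. -/
def ofAction {K : Type u} {Q : Type v} [Group K] [Group Q] (φ : Q →* MulAut K) :
    DoubleGroup K Q (Q × K) where
  top s := φ s.1 s.2
  bot s := s.2
  left s := s.1
  right s := s.1
  hcomp s t _ := (s.1, s.2 * t.2)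
  vcomp s t _ := (s.1 * t.1, t.2)
  hid q := (q, 1)
  vid k := (1, k)
  hinv s := (s.1, s.2⁻¹)
  vinv s := (s.1⁻¹, φ s.1 s.2)
  left_hcomp _ _ _ := rfl
  right_hcomp _ _ h := h
  top_hcomp s t h := by
    have h : s.1 = t.1 := h
    rw [map_mul, h]
  bot_hcomp _ _ _ := rfl
  top_vcomp s t h := by
    have h : s.2 = φ t.1 t.2 := h
    rw [map_mul, MulAut.mul_apply, h]
  bot_vcomp _ _ _ := rfl
  left_vcomp _ _ _ := rfl
  right_vcomp _ _ _ := rfl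
  left_hid _ := rfl
  right_hid _ := rfl
  top_hid q := map_one (φ q)
  bot_hid _ := rfl
  top_vid k := by simp
  bot_vid _ := rfl
  left_vid _ := rfl
  right_vid _ := rfl
  left_hinv _ := rfl
  right_hinv _ := rfl
  top_vinv s := by simp
  bot_vinv _ := rfl
  hcomp_assoc s t u _ _ := by simp [mul_assoc]
  vcomp_assoc s t u _ _ := by simp [mul_assoc]
  hid_hcomp s := by simp
  hcomp_hid s := by simp
  vid_vcomp s := by simp
  vcomp_vid s := by simp
  hinv_hcomp s := by simp
  hcomp_hinv s := by simp
  vinv_vcomp s := by simp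
  vcomp_vinv s := by simp
  hid_mul a b := by simp
  vid_mul a b := by simp
  hid_one := rfl
  interchange _ _ _ _ _ _ _ _ := rfl

/-- The 2-cochain of `D(Q, K, φ)` given by `ω` and `η`: the value on the horizontal pair
`(q, k), (q, l)` is `ω q k l`, that on the vertical pair `(q, φ_{q'} k), (q', k)` is
`η k q q'`. -/
def cochainOfPair {K : Type u} {Q : Type v} [Group K] [Group Q] (φ : Q →* MulAut K)
    (ω : Q → K → K → A) (η : K → Q → Q → A) : (ofAction φ).C2 A :=
  (fun p => ω p.1.1.1 p.1.1.2 p.1.2.2, fun p => η p.1.2.2 p.1.1.1 p.1.2.1)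

end DoubleGroup

end DoubleGroup

end VecActions

namespace VecActions

/-! ### Monoidal natural transformations and units -/

/-! The theorem rests on an equivalence of groupoids between actions on `Vec_K` and pairs `(ω, η)`
of numerical cocycles. The objects `δ_k` generate `Vec_K`, their endomorphisms are scalars, there
are no nonzero morphisms between different ones, and `δ_k ⊗ δ_l ≅ δ_{kl}` with trivial associativity
constraint; `PointedBasis` records just this. Once isomorphisms `T_q δ_k ≅ δ_{φ_q k}` are chosen,
each structure morphism on simple objects is a number and each axiom is an equation between numbers.
Associativity of the tensor structure of `T_q`, monoidality of `T_q T_{q'} ⟶ T_{qq'}` and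
associativity of the action become the three equations of `IsCocycleOver` (`Scalars.isCocycleOver`).
A morphism of actions becomes a 1-cochain that relates two pairs (`Scalars.exists_isRelatedBy`).

Conversely, a natural transformation between linear functors can be prescribed freely on simple
objects (`PointedBasis.exists_natTrans`), and equations between composites can be tested there. So
numbers that satisfy the equations produce tensor structures (`exists_monoidal`), actions on
regrading functors (`exists_action`) and morphisms (`Scalars.exists_hom`). Units carry no further
data: compatibility with them is automatic (`unit_of_tensor`), and the unit constraints are forced
by the values of `ω` and `η` at 1, which need not be normalized.

Hence `cocycleFunctor`, used both for actions over `φ` and for actions that fix isomorphism classes,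
is an equivalence in both cases, and the pairs that give `T` form one isomorphism class
(`exists_scalars_iff`). The parts of the theorem are readings of this. The equations and relations
on pairs are those of 2-cocycles and coboundaries of the double group (`cochainOfPair_mem_Z2_iff`,
`mk_cocycleOfPair_eq_iff`). For trivial `φ` they are symmetric under exchange of `(Q, ω)` and `(K,
η)` (`CocyclePair.swapEquivalence`). -/

/-- A natural transformation of monoidal functors that respects the tensor structures, and is
invertible at the unit, respects the units. -/
lemma unit_of_tensor {C D : Type*} [Category* C] [MonoidalCategory C] [Category* D]
    [MonoidalCategory D] {F G : C ⥤ D} [F.LaxMonoidal] [G.LaxMonoidal] [IsIso (ε G)]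
    [IsIso (μ G (𝟙_ C) (𝟙_ C))] (α : F ⟶ G) [IsIso (α.app (𝟙_ C))]
    (h : μ F (𝟙_ C) (𝟙_ C) ≫ α.app (𝟙_ C ⊗ 𝟙_ C) =
      (α.app (𝟙_ C) ⊗ₘ α.app (𝟙_ C)) ≫ μ G (𝟙_ C) (𝟙_ C)) :
    ε F ≫ α.app (𝟙_ C) = ε G := by
  -- Both `ε F ≫ α` and `ε G` solve the left unit equation of `G`; invertibility of `μ G` and then
  -- of `ε G` makes the solution unique.
  have h₁ : (ε F ≫ α.app (𝟙_ C)) ▷ G.obj (𝟙_ C) ≫ μ G (𝟙_ C) (𝟙_ C) ≫ G.map (λ_ (𝟙_ C)).hom =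
      (λ_ (G.obj (𝟙_ C))).hom := by
    rw [← cancel_epi (𝟙_ D ◁ α.app (𝟙_ C)), leftUnitor_naturality, left_unitality F,
      Category.assoc, Category.assoc, α.naturality, reassoc_of% h, MonoidalCategory.tensorHom_def,
      comp_whiskerRight]
    simp only [Category.assoc, ← whisker_exchange_assoc]
  rw [left_unitality G, ← Category.assoc, ← Category.assoc, cancel_mono, cancel_mono] at h₁
  have h₂ := congrArg (fun f => 𝟙_ D ◁ ε G ≫ f) h₁
  simp only [whisker_exchange] at h₂
  rw [cancel_mono] at h₂
  simpa [← cancel_mono (ρ_ (G.obj (𝟙_ C))).inv] using h₂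

/-! ### Categories generated by a family of objects -/

section Generators

variable {C : Type*} [Category* C] [Preadditive C] {I : Type*}

/-- Every identity morphism is a finite sum of morphisms that factor through members of the
family `δ`. -/
def Generates (δ : I → C) : Prop :=
  ∀ X : C, ∃ (n : ℕ) (k : Fin n → I) (p : ∀ a, X ⟶ δ (k a)) (i : ∀ a, δ (k a) ⟶ X),
    ∑ a, p a ≫ i a = 𝟙 X

namespace Generates

variable {δ : I → C} {D : Type*} [Category* D] [Preadditive D]

/-- An additive `F` carries the decomposition of `𝟙 X` to one of `𝟙 (F X)`. The general `F` lets the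
lemma be applied to composites with tensoring functors. -/
lemma hom_ext (hδ : Generates δ) (F : C ⥤ D) [F.Additive] {X : C} {Z : D} {f g : F.obj X ⟶ Z}
    (h : ∀ k (i : δ k ⟶ X), F.map i ≫ f = F.map i ≫ g) : f = g := by
  obtain ⟨n, k, p, i, hX⟩ := hδ X
  rw [← Category.id_comp f, ← Category.id_comp g, ← F.map_id, ← hX, F.map_sum,
    Preadditive.sum_comp, Preadditive.sum_comp]
  simp [h]

lemma natTrans_ext (hδ : Generates δ) {F G : C ⥤ D} [F.Additive] {α β : F ⟶ G}
    (h : ∀ k, α.app (δ k) = β.app (δ k)) : α = β := by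
  ext X
  refine hδ.hom_ext F fun k i => ?_
  simp [h]

/-- A natural transformation can be prescribed on a generating family. -/
lemma exists_natTrans (hδ : Generates δ) (F G : C ⥤ D) [F.Additive] [G.Additive]
    (α : ∀ k, F.obj (δ k) ⟶ G.obj (δ k))
    (hα : ∀ k l (f : δ k ⟶ δ l), F.map f ≫ α l = α k ≫ G.map f) :
    ∃ β : F ⟶ G, ∀ k, β.app (δ k) = α k := by
  choose n k p i hX using hδ
  -- The component at `X` is built from a chosen decomposition, but this identity determines it by
  -- `hom_ext`; naturality and the prescribed values both follow.
  have key : ∀ l X (j : δ l ⟶ X), F.map j ≫ ∑ a, F.map (p X a) ≫ α (k X a) ≫ G.map (i X a) =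
      α l ≫ G.map j := by
    intro l X j
    conv_rhs =>
      rw [← Category.comp_id j, ← hX, Preadditive.comp_sum, G.map_sum, Preadditive.comp_sum]
    rw [Preadditive.comp_sum]
    refine Finset.sum_congr rfl fun a _ => ?_
    simp only [← Category.assoc, ← F.map_comp, hα]
    simp
  refine ⟨⟨fun X => ∑ a, F.map (p X a) ≫ α (k X a) ≫ G.map (i X a), fun X Y f => ?_⟩, fun l => ?_⟩
  · refine hom_ext (fun X => ⟨n X, k X, p X, i X, hX X⟩) F fun l j => ?_
    rw [← F.map_comp_assoc, key, reassoc_of% key, G.map_comp]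
  · simpa using key l (δ l) (𝟙 _)

end Generates

end Generators

/-! ### Pointed tensor categories and their scalars -/

/-- A tensor category generated by simple objects `δ k` that multiply like the elements of the
group `K`, with trivial associativity constraint. -/
structure PointedBasis (K : Type*) [Group K] (C : Type*) [Category* C] [MonoidalCategory C]
    [Preadditive C] [Linear ℂ C] where
  δ : K → C
  mul (k l : K) : δ k ⊗ δ l ≅ δ (k * l)
  one : 𝟙_ C ≅ δ 1
  assoc (k l m : K) :
    (mul k l).hom ▷ δ m ≫ (mul (k * l) m).hom ≫ eqToHom (congrArg δ (mul_assoc k l m)) =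
      (α_ _ _ _).hom ≫ δ k ◁ (mul l m).hom ≫ (mul k (l * m)).hom
  one_leftUnit (k : K) :
    one.hom ▷ δ k ≫ (mul 1 k).hom ≫ eqToHom (congrArg δ (one_mul k)) = (λ_ (δ k)).hom
  one_rightUnit (k : K) :
    δ k ◁ one.hom ≫ (mul k 1).hom ≫ eqToHom (congrArg δ (mul_one k)) = (ρ_ (δ k)).hom
  scalar (k : K) (f : δ k ⟶ δ k) : ∃ c : ℂ, f = c • 𝟙 _
  id_ne_zero (k : K) : 𝟙 (δ k) ≠ 0
  eq_zero (k l : K) (h : k ≠ l) (f : δ k ⟶ δ l) : f = 0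
  generates : Generates δ

namespace PointedBasis

variable {K : Type u} [Group K] {C : Type v} [Category.{w} C] [MonoidalCategory C]
  [Preadditive C] [Linear ℂ C] (B : PointedBasis K C)

/-- With respect to isomorphisms of `X` and `Y` with simple objects, the morphism `f` is the
scalar `c`. -/
def IsScalar {X Y : C} {k l : K} (x : X ≅ B.δ k) (y : Y ≅ B.δ l) (c : ℂ) (f : X ⟶ Y) : Prop :=
  ∃ h : k = l, f ≫ y.hom = c • (x.hom ≫ eqToHom (congrArg B.δ h))

/-- The identification of `X ⊗ Y` with a simple object. -/
def tensor {X Y : C} {k l : K} (x : X ≅ B.δ k) (y : Y ≅ B.δ l) : X ⊗ Y ≅ B.δ (k * l) :=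
  (x ⊗ᵢ y) ≪≫ B.mul k l

/-- The identification of `F X` with a simple object. -/
def map {φ : K → K} {F : C ⥤ C} (θ : ∀ k, F.obj (B.δ k) ≅ B.δ (φ k)) {X : C} {k : K}
    (x : X ≅ B.δ k) : F.obj X ≅ B.δ (φ k) :=
  F.mapIso x ≪≫ θ k

variable {B}

namespace IsScalar

variable {X Y Z X' Y' : C} {k l m k' l' : K} {x : X ≅ B.δ k} {y : Y ≅ B.δ l} {z : Z ≅ B.δ m}
  {x' : X' ≅ B.δ k'} {y' : Y' ≅ B.δ l'} {c d : ℂ} {f g : X ⟶ Y}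

lemma id (x : X ≅ B.δ k) : B.IsScalar x x 1 (𝟙 X) := ⟨rfl, by simp⟩

lemma congr (hf : B.IsScalar x y c f) (h : f = g) : B.IsScalar x y c g := h ▸ hf

lemma comp {g : Y ⟶ Z} (hf : B.IsScalar x y c f) (hg : B.IsScalar y z d g) :
    B.IsScalar x z (c * d) (f ≫ g) := by
  obtain ⟨rfl, hf⟩ := hf
  obtain ⟨rfl, hg⟩ := hg
  refine ⟨rfl, ?_⟩
  simp only [eqToHom_refl, Category.comp_id] at hf hg ⊢
  rw [Category.assoc, hg, Linear.comp_smul, hf, smul_smul, mul_comm]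

lemma hom_ext (hf : B.IsScalar x y c f) (hg : B.IsScalar x y d g) (h : c = d) :
    f = g := by
  rw [← cancel_mono y.hom, hf.2, hg.2, h]

/-- As `𝟙 (δ k)` is nonzero, an equality of morphisms yields an equation of numbers; `hom_ext` is
the way back. -/
lemma unique (hf : B.IsScalar x y c f) (hg : B.IsScalar x y d f) : c = d := by
  obtain ⟨rfl, hf⟩ := hf
  have h := hf.symm.trans hg.2
  simp only [eqToHom_refl, Category.comp_id] at h
  have h' : (c - d) • 𝟙 (B.δ k) = 0 := by
    rw [← cancel_epi x.hom, Linear.comp_smul, Category.comp_id, sub_smul, h, sub_self,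
      Limits.comp_zero]
  exact sub_eq_zero.1 ((smul_eq_zero.1 h').resolve_right (B.id_ne_zero k))

lemma exists_scalar (x : X ≅ B.δ k) (y : Y ≅ B.δ l) (h : k = l) (f : X ⟶ Y) :
    ∃ c, B.IsScalar x y c f := by
  subst h
  obtain ⟨c, hc⟩ := B.scalar k (x.inv ≫ f ≫ y.hom)
  exact ⟨c, rfl, by simpa [← cancel_epi x.inv] using hc⟩

/-- There is a morphism with a given scalar. -/
lemma exists_hom (x : X ≅ B.δ k) (y : Y ≅ B.δ l) (h : k = l) (c : ℂ) :
    ∃ f : X ⟶ Y, B.IsScalar x y c f := by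
  subst h
  exact ⟨c • (x.hom ≫ y.inv), rfl, by simp⟩

lemma exists_unit (x : X ≅ B.δ k) (y : Y ≅ B.δ l) (h : k = l) (f : X ⟶ Y) [IsIso f] :
    ∃ c : ℂˣ, B.IsScalar x y c f := by
  obtain ⟨c, hc⟩ := exists_scalar x y h f
  obtain ⟨d, hd⟩ := exists_scalar y x h.symm (inv f)
  have h₁ : c * d = 1 := (hc.comp hd).unique (by simpa using id x)
  exact ⟨⟨c, d, h₁, by rw [mul_comm, h₁]⟩, hc⟩

lemma exists_iso (x : X ≅ B.δ k) (y : Y ≅ B.δ l) (h : k = l) (c : ℂˣ) :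
    ∃ f : X ≅ Y, B.IsScalar x y c f.hom := by
  obtain ⟨f, hf⟩ := exists_hom x y h c
  obtain ⟨g, hg⟩ := exists_hom y x h.symm (c⁻¹ : ℂˣ)
  refine ⟨⟨f, g, (hf.comp hg).hom_ext (id x) (by simp),
    (hg.comp hf).hom_ext (id y) (by simp)⟩, hf⟩

lemma tensorHom [MonoidalPreadditive C] [MonoidalLinear ℂ C] {f' : X' ⟶ Y'}
    (hf : B.IsScalar x y c f) (hf' : B.IsScalar x' y' d f') :
    B.IsScalar (B.tensor x x') (B.tensor y y') (c * d) (f ⊗ₘ f') := by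
  obtain ⟨rfl, hf⟩ := hf
  obtain ⟨rfl, hf'⟩ := hf'
  refine ⟨rfl, ?_⟩
  simp only [eqToHom_refl, Category.comp_id] at hf hf' ⊢
  simp only [PointedBasis.tensor, Iso.trans_hom, tensorIso_hom]
  rw [MonoidalCategory.tensorHom_comp_tensorHom_assoc, hf, hf',
    MonoidalCategory.tensorHom_def]
  simp [MonoidalCategory.tensorHom_def, smul_smul, mul_comm]

lemma whiskerRight [MonoidalPreadditive C] [MonoidalLinear ℂ C] (hf : B.IsScalar x y c f)
    (z : Z ≅ B.δ m) : B.IsScalar (B.tensor x z) (B.tensor y z) c (f ▷ Z) := by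
  simpa using hf.tensorHom (id z)

lemma whiskerLeft [MonoidalPreadditive C] [MonoidalLinear ℂ C] (z : Z ≅ B.δ m)
    (hf : B.IsScalar x y c f) : B.IsScalar (B.tensor z x) (B.tensor z y) c (Z ◁ f) := by
  simpa using (id z).tensorHom hf

/-- The axiom `assoc` is the case of simple objects, and naturality transports it. Thus associators
contribute nothing to the scalar equations. -/
lemma associator (x : X ≅ B.δ k) (y : Y ≅ B.δ l) (z : Z ≅ B.δ m) :
    B.IsScalar (B.tensor (B.tensor x y) z) (B.tensor x (B.tensor y z)) 1 (α_ X Y Z).hom := by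
  refine ⟨mul_assoc k l m, ?_⟩
  have h₁ : (((x.hom ⊗ₘ y.hom) ≫ (B.mul k l).hom) ⊗ₘ z.hom) =
      ((x.hom ⊗ₘ y.hom) ⊗ₘ z.hom) ≫ (B.mul k l).hom ▷ B.δ m := by
    rw [← tensorHom_id, MonoidalCategory.tensorHom_comp_tensorHom, Category.comp_id]
  have h₂ : (x.hom ⊗ₘ ((y.hom ⊗ₘ z.hom) ≫ (B.mul l m).hom)) =
      (x.hom ⊗ₘ (y.hom ⊗ₘ z.hom)) ≫ B.δ k ◁ (B.mul l m).hom := by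
    rw [← id_tensorHom, MonoidalCategory.tensorHom_comp_tensorHom, Category.comp_id]
  simp only [PointedBasis.tensor, Iso.trans_hom, tensorIso_hom, one_smul, Category.assoc, h₁, h₂,
    B.assoc, associator_naturality_assoc]

lemma leftUnitor (x : X ≅ B.δ k) : B.IsScalar (B.tensor B.one x) x 1 (λ_ X).hom := by
  refine ⟨one_mul k, ?_⟩
  have h := B.one_leftUnit k
  simp only [PointedBasis.tensor, Iso.trans_hom, tensorIso_hom, one_smul, Category.assoc,
    MonoidalCategory.tensorHom_def', h, leftUnitor_naturality]

lemma rightUnitor (x : X ≅ B.δ k) : B.IsScalar (B.tensor x B.one) x 1 (ρ_ X).hom := by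
  refine ⟨mul_one k, ?_⟩
  have h := B.one_rightUnit k
  simp only [PointedBasis.tensor, Iso.trans_hom, tensorIso_hom, one_smul, Category.assoc,
    MonoidalCategory.tensorHom_def, h, rightUnitor_naturality]

lemma map {φ : K → K} {F : C ⥤ C} [F.Additive] [F.Linear ℂ]
    (θ : ∀ k, F.obj (B.δ k) ≅ B.δ (φ k)) (hf : B.IsScalar x y c f) :
    B.IsScalar (B.map θ x) (B.map θ y) c (F.map f) := by
  obtain ⟨rfl, hf⟩ := hf
  refine ⟨rfl, ?_⟩
  simp only [eqToHom_refl, Category.comp_id] at hf ⊢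
  simp only [PointedBasis.map, Iso.trans_hom, Functor.mapIso_hom, ← F.map_comp_assoc, hf]
  simp [F.map_smul]

/-- By naturality the scalar on `δ k` is also the scalar on every object identified with `δ k`, such
as a tensor product or a value of another functor. -/
lemma app {φ ψ : K → K} {F G : C ⥤ C} {θ : ∀ k, F.obj (B.δ k) ≅ B.δ (φ k)}
    {θ' : ∀ k, G.obj (B.δ k) ≅ B.δ (ψ k)} {α : F ⟶ G}
    (h : B.IsScalar (θ k) (θ' k) c (α.app (B.δ k))) (x : X ≅ B.δ k) :
    B.IsScalar (B.map θ x) (B.map θ' x) c (α.app X) := by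
  refine ⟨h.1, ?_⟩
  simp only [PointedBasis.map, Iso.trans_hom, Functor.mapIso_hom, ← α.naturality_assoc, h.2,
    Category.assoc, Linear.comp_smul]

lemma tensorator {φ : K → K} {F : C ⥤ C} [F.LaxMonoidal]
    {θ : ∀ k, F.obj (B.δ k) ≅ B.δ (φ k)}
    (h : B.IsScalar (B.tensor (θ k) (θ l)) (B.map θ (B.mul k l)) c (μ F (B.δ k) (B.δ l)))
    (x : X ≅ B.δ k) (y : Y ≅ B.δ l) :
    B.IsScalar (B.tensor (B.map θ x) (B.map θ y)) (B.map θ (B.tensor x y)) c (μ F X Y) := by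
  refine ⟨h.1, ?_⟩
  have h₂ := h.2
  simp only [PointedBasis.map, PointedBasis.tensor, Iso.trans_hom, Functor.mapIso_hom,
    tensorIso_hom, Functor.map_comp, Category.assoc, ← μ_natural_assoc] at h₂ ⊢
  rw [h₂, ← MonoidalCategory.tensorHom_comp_tensorHom, Linear.comp_smul, Category.assoc]

end IsScalar

end PointedBasis

namespace PointedBasis

variable {K : Type u} [Group K] {C : Type v} [Category.{w} C] [MonoidalCategory C]
  [Preadditive C] [Linear ℂ C] (B : PointedBasis K C)

@[simp]
lemma map_refl {φ : K → K} {F : C ⥤ C} (θ : ∀ k, F.obj (B.δ k) ≅ B.δ (φ k)) (k : K) :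
    B.map θ (Iso.refl (B.δ k)) = θ k := by
  ext
  simp [map]

/-! ### Extension from simple objects -/

section Extension

variable {D : Type*} [Category* D] [Preadditive D] [Linear ℂ D]

/-- No compatibility is asked of `α`: a morphism between simple objects is zero or a scalar, and
linear functors preserve both. -/
lemma exists_natTrans (F G : C ⥤ D) [F.Additive] [F.Linear ℂ] [G.Additive] [G.Linear ℂ]
    (α : ∀ k, F.obj (B.δ k) ⟶ G.obj (B.δ k)) :
    ∃ β : F ⟶ G, ∀ k, β.app (B.δ k) = α k := by
  refine B.generates.exists_natTrans F G α fun k l f => ?_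
  by_cases h : k = l
  · subst h
    obtain ⟨c, rfl⟩ := B.scalar k f
    simp [F.map_smul, G.map_smul]
  · simp [B.eq_zero k l h f]

lemma exists_natIso (F G : C ⥤ D) [F.Additive] [F.Linear ℂ] [G.Additive] [G.Linear ℂ]
    (α : ∀ k, F.obj (B.δ k) ≅ G.obj (B.δ k)) :
    ∃ β : F ≅ G, ∀ k, β.hom.app (B.δ k) = (α k).hom := by
  obtain ⟨β, hβ⟩ := B.exists_natTrans F G fun k => (α k).hom
  obtain ⟨γ, hγ⟩ := B.exists_natTrans G F fun k => (α k).inv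
  exact ⟨⟨β, γ, B.generates.natTrans_ext (by simp [hβ, hγ]),
    B.generates.natTrans_ext (by simp [hβ, hγ])⟩, hβ⟩

end Extension

variable [MonoidalPreadditive C]

/-- Tensoring with a fixed object is additive, so `Generates.hom_ext` applies to one factor at a
time. -/
lemma tensor_hom_ext (F G : C ⥤ C) [F.Additive] [G.Additive] {X Y Z : C}
    {f g : F.obj X ⊗ G.obj Y ⟶ Z}
    (h : ∀ k l (i : B.δ k ⟶ X) (j : B.δ l ⟶ Y),
      (F.map i ⊗ₘ G.map j) ≫ f = (F.map i ⊗ₘ G.map j) ≫ g) : f = g := by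
  refine B.generates.hom_ext (F ⋙ tensorRight (G.obj Y)) fun k i => ?_
  refine B.generates.hom_ext (G ⋙ tensorLeft (F.obj (B.δ k))) fun l j => ?_
  simpa [MonoidalCategory.tensorHom_def'] using h k l i j

lemma tensor_hom_ext₃ (F : C ⥤ C) [F.Additive] {X Y Z W : C}
    {f g : (F.obj X ⊗ F.obj Y) ⊗ F.obj Z ⟶ W}
    (h : ∀ k l m (i : B.δ k ⟶ X) (j : B.δ l ⟶ Y) (p : B.δ m ⟶ Z),
      ((F.map i ⊗ₘ F.map j) ⊗ₘ F.map p) ≫ f = ((F.map i ⊗ₘ F.map j) ⊗ₘ F.map p) ≫ g) :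
    f = g := by
  refine B.generates.hom_ext (F ⋙ tensorLeft (F.obj X ⊗ F.obj Y)) fun m p => ?_
  refine B.generates.hom_ext (F ⋙ tensorRight (F.obj Y) ⋙ tensorRight (F.obj (B.δ m)))
    fun k i => ?_
  refine B.generates.hom_ext (F ⋙ tensorLeft (F.obj (B.δ k)) ⋙ tensorRight (F.obj (B.δ m)))
    fun l j => ?_
  have := h k l m i j p
  rw [MonoidalCategory.tensorHom_def, MonoidalCategory.tensorHom_def', comp_whiskerRight] at this
  simp only [Category.assoc] at this
  exact this

/-- Compatibility of a natural isomorphism with tensor structures can be tested on simple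
objects. -/
lemma isMonoidal_of_simple {F G : C ⥤ C} [F.Additive] [F.Monoidal] [G.Monoidal] (α : F ⟶ G)
    [IsIso α] (h : ∀ k l, μ F (B.δ k) (B.δ l) ≫ α.app (B.δ k ⊗ B.δ l) =
      (α.app (B.δ k) ⊗ₘ α.app (B.δ l)) ≫ μ G (B.δ k) (B.δ l)) :
    NatTrans.IsMonoidal α := by
  have h' (X Y : C) : μ F X Y ≫ α.app (X ⊗ Y) = (α.app X ⊗ₘ α.app Y) ≫ μ G X Y := by
    refine B.tensor_hom_ext F F fun k l i j => ?_
    rw [μ_natural_assoc, α.naturality, reassoc_of% h, ← μ_natural,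
      MonoidalCategory.tensorHom_comp_tensorHom_assoc,
      MonoidalCategory.tensorHom_comp_tensorHom_assoc, α.naturality, α.naturality]
  exact ⟨unit_of_tensor α (h' _ _), h'⟩

variable [MonoidalLinear ℂ C]

/-- A transformation natural in two variables is one between functors into `C ⥤ C`. The family is
extended from simple objects in the second variable, then in the first. -/
lemma exists_tensorator (F : C ⥤ C) [F.Additive] [F.Linear ℂ]
    (α : ∀ k l, F.obj (B.δ k) ⊗ F.obj (B.δ l) ≅ F.obj (B.δ k ⊗ B.δ l)) :
    ∃ β : ∀ X Y, F.obj X ⊗ F.obj Y ≅ F.obj (X ⊗ Y),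
      (∀ k l, (β (B.δ k) (B.δ l)).hom = (α k l).hom) ∧
      ∀ {X Y X' Y' : C} (f : X ⟶ Y) (g : X' ⟶ Y'),
        (F.map f ⊗ₘ F.map g) ≫ (β Y Y').hom = (β X X').hom ≫ F.map (f ⊗ₘ g) := by
  let G : C ⥤ C ⥤ C := F ⋙ tensoringLeft C ⋙ (Functor.whiskeringLeft C C C).obj F
  let H : C ⥤ C ⥤ C := tensoringLeft C ⋙ (Functor.whiskeringRight C C C).obj F
  have hG : G.Additive := { map_add := by intros; ext; simp [G] }
  have hG' : G.Linear ℂ := { map_smul := by intros; ext; simp [G] }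
  have hH : H.Additive := { map_add := by intros; ext; simp [H] }
  have hH' : H.Linear ℂ := { map_smul := by intros; ext; simp [H] }
  have hα (k : K) := B.exists_natIso (F ⋙ tensorLeft (F.obj (B.δ k))) (tensorLeft (B.δ k) ⋙ F)
    (α k)
  choose α' hα' using hα
  obtain ⟨β, hβ⟩ := B.exists_natIso G H α'
  refine ⟨fun X Y => (β.app X).app Y, fun k l => ?_, fun {X Y X' Y'} f g => ?_⟩
  · exact (congrArg (fun γ => γ.app (B.δ l)) (hβ k)).trans (hα' k l)
  · have h₁ := congrArg (fun γ => γ.app X') (β.hom.naturality f)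
    have h₂ := (β.hom.app Y).naturality g
    simp only [G, H] at h₁ h₂
    dsimp at h₁ h₂ ⊢
    rw [MonoidalCategory.tensorHom_def, MonoidalCategory.tensorHom_def, Category.assoc, h₂,
      reassoc_of% h₁, F.map_comp]

/-- A functor that permutes the simple objects by a homomorphism has a tensor structure given by
any 2-cocycle. -/
lemma exists_monoidal (φ : K →* K) (F : C ⥤ C) [F.Additive] [F.Linear ℂ]
    (θ : ∀ k, F.obj (B.δ k) ≅ B.δ (φ k)) (ω : K → K → ℂˣ)
    (hω : ∀ k l m, ω l m * ω k (l * m) = ω (k * l) m * ω k l) :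
    ∃ _ : F.Monoidal, ∀ k l, B.IsScalar (B.tensor (θ k) (θ l)) (B.map θ (B.mul k l)) (ω k l)
      (μ F (B.δ k) (B.δ l)) := by
  have hα (k l : K) := IsScalar.exists_iso (B.tensor (θ k) (θ l)) (B.map θ (B.mul k l))
    (map_mul φ k l).symm (ω k l)
  choose α hα using hα
  obtain ⟨β, hβ, hβ'⟩ := B.exists_tensorator F α
  -- Since `ω` need not be normalized, the unit constraint must compensate for `ω 1 1`; the
  -- equalities `ω 1 k = ω 1 1 = ω k 1` below make the same scalar work at every `δ k`.
  obtain ⟨e, he⟩ := IsScalar.exists_iso B.one (B.map θ B.one) (map_one φ).symm (ω 1 1)⁻¹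
  have key {X Y : C} {k l : K} (x : X ≅ B.δ k) (y : Y ≅ B.δ l) :
      B.IsScalar (B.tensor (B.map θ x) (B.map θ y)) (B.map θ (B.tensor x y)) (ω k l)
        (β X Y).hom := by
    have h := hα k l
    rw [← hβ] at h
    refine ⟨h.1, ?_⟩
    have h₂ := h.2
    simp only [PointedBasis.map, PointedBasis.tensor, Iso.trans_hom, Functor.mapIso_hom,
      tensorIso_hom, Functor.map_comp, Category.assoc, ← reassoc_of% hβ'] at h₂ ⊢
    rw [h₂, ← MonoidalCategory.tensorHom_comp_tensorHom, Linear.comp_smul, Category.assoc]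
  have hω₁ (k : K) : ω 1 k = ω 1 1 := by simpa using hω 1 1 k
  have hω₂ (k : K) : ω k 1 = ω 1 1 := by simpa using (hω k 1 1).symm
  have hβl {X Y : C} (f : X ⟶ Y) (X' : C) :
      F.map f ▷ F.obj X' ≫ (β Y X').hom = (β X X').hom ≫ F.map (f ▷ X') := by
    simpa using hβ' f (𝟙 X')
  have hβr {X Y : C} (X' : C) (f : X ⟶ Y) :
      F.obj X' ◁ F.map f ≫ (β X' Y).hom = (β X' X).hom ≫ F.map (X' ◁ f) := by
    simpa using hβ' (𝟙 X') f
  let M : F.CoreMonoidal :=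
    { εIso := e
      μIso := β
      μIso_hom_natural_left := hβl
      μIso_hom_natural_right := hβr
      associativity X Y Z := by
        -- Both sides are natural in the three objects, so only simple ones matter, and there the
        -- equation is `hω`.
        refine B.tensor_hom_ext₃ F fun k l m i j p => ?_
        have h : (β (B.δ k) (B.δ l)).hom ▷ F.obj (B.δ m) ≫ (β (B.δ k ⊗ B.δ l) (B.δ m)).hom ≫
              F.map (α_ _ _ _).hom =
            (α_ _ _ _).hom ≫ F.obj (B.δ k) ◁ (β (B.δ l) (B.δ m)).hom ≫
              (β (B.δ k) (B.δ l ⊗ B.δ m)).hom := by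
          let x := Iso.refl (B.δ k)
          let y := Iso.refl (B.δ l)
          let z := Iso.refl (B.δ m)
          have h₁ := ((key x y).whiskerRight (B.map θ z)).comp
            ((key (B.tensor x y) z).comp ((IsScalar.associator x y z).map θ))
          have h₂ := (IsScalar.associator (B.map θ x) (B.map θ y) (B.map θ z)).comp
            (((key y z).whiskerLeft (B.map θ x)).comp (key x (B.tensor y z)))
          refine h₁.hom_ext h₂ ?_
          have := congrArg (Units.val) (hω k l m)
          push_cast at this ⊢
          linear_combination -this
        have h₁ : ((F.map i ⊗ₘ F.map j) ⊗ₘ F.map p) ≫ (β X Y).hom ▷ F.obj Z =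
            (β (B.δ k) (B.δ l)).hom ▷ F.obj (B.δ m) ≫ (F.map (i ⊗ₘ j) ⊗ₘ F.map p) := by
          rw [← tensorHom_id, MonoidalCategory.tensorHom_comp_tensorHom, hβ', ← tensorHom_id,
            MonoidalCategory.tensorHom_comp_tensorHom]
          simp
        have h₂ : (F.map i ⊗ₘ (F.map j ⊗ₘ F.map p)) ≫ F.obj X ◁ (β Y Z).hom =
            F.obj (B.δ k) ◁ (β (B.δ l) (B.δ m)).hom ≫ (F.map i ⊗ₘ F.map (j ⊗ₘ p)) := by
          rw [← id_tensorHom, MonoidalCategory.tensorHom_comp_tensorHom, hβ', ← id_tensorHom,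
            MonoidalCategory.tensorHom_comp_tensorHom]
          simp
        rw [reassoc_of% h₁, reassoc_of% hβ', ← F.map_comp, associator_naturality, F.map_comp,
          reassoc_of% h, associator_naturality_assoc, reassoc_of% h₂, hβ']
      left_unitality X := by
        refine B.generates.hom_ext (F ⋙ tensorLeft (𝟙_ C)) fun k i => ?_
        have h : (λ_ (F.obj (B.δ k))).hom =
            e.hom ▷ F.obj (B.δ k) ≫ (β (𝟙_ C) (B.δ k)).hom ≫ F.map (λ_ (B.δ k)).hom := by
          have h₁ := (he.whiskerRight (B.map θ (Iso.refl (B.δ k)))).comp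
            ((key B.one (Iso.refl (B.δ k))).comp ((IsScalar.leftUnitor (Iso.refl _)).map θ))
          refine (IsScalar.leftUnitor (B.map θ (Iso.refl (B.δ k)))).hom_ext h₁ ?_
          simp [hω₁]
        dsimp
        rw [leftUnitor_naturality, h, whisker_exchange_assoc, reassoc_of% hβr, ← F.map_comp,
          leftUnitor_naturality, F.map_comp, Category.assoc, Category.assoc]
      right_unitality X := by
        refine B.generates.hom_ext (F ⋙ tensorRight (𝟙_ C)) fun k i => ?_
        have h : (ρ_ (F.obj (B.δ k))).hom =
            F.obj (B.δ k) ◁ e.hom ≫ (β (B.δ k) (𝟙_ C)).hom ≫ F.map (ρ_ (B.δ k)).hom := by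
          have h₁ := (he.whiskerLeft (B.map θ (Iso.refl (B.δ k)))).comp
            ((key (Iso.refl (B.δ k)) B.one).comp ((IsScalar.rightUnitor (Iso.refl _)).map θ))
          refine (IsScalar.rightUnitor (B.map θ (Iso.refl (B.δ k)))).hom_ext h₁ ?_
          simp [hω₂]
        dsimp
        rw [rightUnitor_naturality, h, ← whisker_exchange_assoc, reassoc_of% hβl, ← F.map_comp,
          rightUnitor_naturality, F.map_comp, Category.assoc, Category.assoc] }
  exact ⟨M.toMonoidal, fun k l => by
    have h := hα k l
    rwa [← hβ] at h⟩

/-- The two sides of the equation are the scalars of the two composites in the monoidality square at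
`δ k`, `δ l`; by `isMonoidal_of_simple` no other square has to be checked. -/
lemma isMonoidal_of_scalar {φ ψ : K → K} {F G : C ⥤ C} [F.Additive] [F.Monoidal] [G.Monoidal]
    (α : F ⟶ G) [IsIso α] {θ : ∀ k, F.obj (B.δ k) ≅ B.δ (φ k)}
    {θ' : ∀ k, G.obj (B.δ k) ≅ B.δ (ψ k)} {ω ω' : K → K → ℂˣ} {c : K → ℂˣ}
    (hα : ∀ k, B.IsScalar (θ k) (θ' k) (c k) (α.app (B.δ k)))
    (hω : ∀ k l, B.IsScalar (B.tensor (θ k) (θ l)) (B.map θ (B.mul k l)) (ω k l)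
      (μ F (B.δ k) (B.δ l)))
    (hω' : ∀ k l, B.IsScalar (B.tensor (θ' k) (θ' l)) (B.map θ' (B.mul k l)) (ω' k l)
      (μ G (B.δ k) (B.δ l))) :
    NatTrans.IsMonoidal α ↔ ∀ k l, ω k l * c (k * l) = c k * c l * ω' k l := by
  have h₁ k l := (hω k l).comp ((hα (k * l)).app (B.mul k l))
  have h₂ k l := ((hα k).tensorHom (hα l)).comp (hω' k l)
  refine ⟨fun h k l => ?_, fun h => B.isMonoidal_of_simple α fun k l => ?_⟩
  · have h₃ := h₁ k l
    rw [NatTrans.IsMonoidal.tensor] at h₃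
    ext
    simpa using h₃.unique (h₂ k l)
  · refine (h₁ k l).hom_ext (h₂ k l) ?_
    exact_mod_cast h k l

end PointedBasis

/-! ### The scalar equations for actions and their morphisms -/

section Relations

variable {K : Type*} [Group K] {Q : Type*} [Group Q] (φ : Q →* MulAut K)

/-- The conditions on `(ω, η)` to be a 2-cocycle of the double group `D(Q, K, φ)`. -/
structure IsCocycleOver (ω : Q → K → K → ℂˣ) (η : K → Q → Q → ℂˣ) : Prop where
  dk (q : Q) (k l m : K) : ω q l m * ω q k (l * m) = ω q (k * l) m * ω q k l
  mixed (q q' : Q) (k l : K) :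
    ω q (φ q' k) (φ q' l) * ω q' k l * η (k * l) q q' =
      η k q q' * η l q q' * ω (q * q') k l
  dq (k : K) (q q' q'' : Q) :
    η (φ q'' k) q q' * η k (q * q') q'' = η k q' q'' * η k q (q' * q'')

/-- The cochain `c` relates `(ω, η)` to `(ω', η')`. -/
structure IsRelatedBy (c : Q → K → ℂˣ) (ω : Q → K → K → ℂˣ) (η : K → Q → Q → ℂˣ)
    (ω' : Q → K → K → ℂˣ) (η' : K → Q → Q → ℂˣ) : Prop where
  left (q : Q) (k l : K) : ω q k l * c q (k * l) = c q k * c q l * ω' q k l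
  right (q q' : Q) (k : K) :
    η k q q' * c (q * q') k = c q (φ q' k) * c q' k * η' k q q'

end Relations

/-- The associator of `TensorAut C` has identity components and drops out; that of `Discrete Q`
stays, because `q * q' * q''` and `q * (q' * q'')` are only propositionally equal. -/
lemma TensorAction.actMul_assoc {C : Type*} [Category* C] [MonoidalCategory C] [Preadditive C]
    [Linear ℂ C] {Q : Type*} [Group Q] (T : TensorAction C Q) (q q' q'' : Q) (X : C) :
    T.actMul q q' ((T.act q'').functor.obj X) ≫ T.actMul (q * q') q'' X ≫
        (TensorAut.Hom.iso
          (T.map (α_ (Discrete.mk q) (Discrete.mk q') (Discrete.mk q'')).hom)).hom.app X =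
      (T.act q).functor.map (T.actMul q' q'' X) ≫ T.actMul q (q' * q'') X := by
  have h := congrArg (fun α => (TensorAut.Hom.iso α).hom.app X)
    (associativity T.toFunctor (Discrete.mk q) (Discrete.mk q') (Discrete.mk q''))
  simp only [TensorAut.comp_iso_hom_app, TensorAut.whiskerRight_app, TensorAut.whiskerLeft_app,
    TensorAut.associator_hom_app] at h
  exact h.trans (Category.id_comp _)

/-! ### Scalars of tensor autoequivalences and of actions -/

namespace PointedBasis

variable {K : Type u} [Group K] {C : Type v} [Category.{w} C] [MonoidalCategory C]
  [Preadditive C] [Linear ℂ C] (B : PointedBasis K C)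

lemma tensorAut_hom_ext {F G : TensorAut C} {α β : F ⟶ G}
    (h : ∀ k, α.iso.hom.app (B.δ k) = β.iso.hom.app (B.δ k)) : α = β :=
  TensorAut.Hom.ext (Iso.ext (B.generates.natTrans_ext h))

lemma map_comp {φ ψ : K → K} {F G : C ⥤ C} (θ : ∀ k, F.obj (B.δ k) ≅ B.δ (φ k))
    (θ' : ∀ k, G.obj (B.δ k) ≅ B.δ (ψ k)) {X : C} {k : K} (x : X ≅ B.δ k) :
    B.map (φ := fun k => ψ (φ k)) (F := F ⋙ G) (fun k => B.map θ' (θ k)) x =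
      B.map θ' (B.map θ x) := by
  ext
  simp [map]

/-- The scalars of a tensor autoequivalence. -/
def TensorScalars (F : TensorAut C) {φ : K → K} (θ : ∀ k, F.functor.obj (B.δ k) ≅ B.δ (φ k))
    (ω : K → K → ℂˣ) : Prop :=
  ∀ k l, B.IsScalar (B.tensor (θ k) (θ l)) (B.map θ (B.mul k l)) (ω k l)
    (F.tensorMap (B.δ k) (B.δ l))

-- The tensor structure of the composite is that of `G` at `F δ_k`, `F δ_l`, followed by the image
-- under `G` of that of `F`. This puts `φ k`, `φ l` into `ω'`, and is the origin of the twist in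
-- `IsCocycleOver.mixed`.
variable {B} in
lemma TensorScalars.comp {F G : TensorAut C} {φ ψ : K → K}
    {θ : ∀ k, F.functor.obj (B.δ k) ≅ B.δ (φ k)} {θ' : ∀ k, G.functor.obj (B.δ k) ≅ B.δ (ψ k)}
    {ω ω' : K → K → ℂˣ} (h : B.TensorScalars F θ ω) (h' : B.TensorScalars G θ' ω') :
    B.TensorScalars (φ := fun k => ψ (φ k)) (G ⊗ F) (fun k => B.map θ' (θ k))
      (fun k l => ω' (φ k) (φ l) * ω k l) := by
  intro k l
  have h₁ := (h' (φ k) (φ l)).tensorator (θ k) (θ l)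
  have h₂ := h₁.comp ((h k l).map θ')
  rw [← map_comp] at h₂
  exact_mod_cast h₂

lemma tensorScalars_unit :
    B.TensorScalars (φ := fun k => k) (𝟙_ (TensorAut C)) (fun _ => Iso.refl _)
      (fun _ _ => 1) := by
  intro k l
  refine ⟨rfl, ?_⟩
  simp only [tensor, map]
  exact (Category.id_comp _).trans (by simp)

/-! ### The scalars of an action -/

variable {Q : Type*} [Group Q] {φ : Q →* MulAut K}

lemma isScalar_map (T : Discrete Q ⥤ TensorAut C)
    (θ : ∀ q k, (T.obj (Discrete.mk q)).functor.obj (B.δ k) ≅ B.δ (φ q k)) {q q' : Q}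
    (f : Discrete.mk q ⟶ Discrete.mk q') (k : K) :
    B.IsScalar (θ q k) (θ q' k) 1 ((TensorAut.Hom.iso (T.map f)).hom.app (B.δ k)) := by
  obtain rfl : q = q' := Discrete.eq_of_hom f
  obtain rfl : f = 𝟙 _ := Subsingleton.elim _ _
  rw [T.map_id]
  exact IsScalar.id _

/-- With respect to the isomorphisms `θ`, the structure of `T` is given by `(ω, η)`. -/
structure Scalars (φ : Q →* MulAut K) (T : TensorAction C Q)
    (θ : ∀ q k, (T.act q).functor.obj (B.δ k) ≅ B.δ (φ q k))
    (ω : Q → K → K → ℂˣ) (η : K → Q → Q → ℂˣ) : Prop where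
  tensor (q : Q) : B.TensorScalars (T.act q) (φ := φ q) (θ q) (ω q)
  mul (q q' : Q) (k : K) : B.IsScalar (B.map (φ := φ q) (θ q) (θ q' k)) (θ (q * q') k) (η k q q')
    (T.actMul q q' (B.δ k))

lemma exists_scalars (T : TensorAction C Q)
    (θ : ∀ q k, (T.act q).functor.obj (B.δ k) ≅ B.δ (φ q k)) :
    ∃ ω η, B.Scalars φ T θ ω η := by
  have h₁ q k l := IsScalar.exists_unit (B.tensor (θ q k) (θ q l))
    (B.map (φ := φ q) (θ q) (B.mul k l)) (map_mul (φ q) k l).symm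
    ((T.act q).tensorMap (B.δ k) (B.δ l))
  have h₂ k q q' := IsScalar.exists_unit (B.map (φ := φ q) (θ q) (θ q' k)) (θ (q * q') k)
    (by rw [map_mul, MulAut.mul_apply]) (T.actMul q q' (B.δ k))
  choose ω hω using h₁
  choose η hη using h₂
  exact ⟨ω, η, hω, fun q q' k => hη k q q'⟩

namespace Scalars

variable {B} {T T' : TensorAction C Q}
  {θ : ∀ q k, (T.act q).functor.obj (B.δ k) ≅ B.δ (φ q k)}
  {θ' : ∀ q k, (T'.act q).functor.obj (B.δ k) ≅ B.δ (φ q k)}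
  {ω ω' : Q → K → K → ℂˣ} {η η' : K → Q → Q → ℂˣ}

/-- Needed at `X = T_{q''} δ_k`, identified with `δ (φ q'' k)`; hence the twisted argument of `η` in
`IsCocycleOver.dq`. -/
lemma mul_app (h : B.Scalars φ T θ ω η) (q q' : Q) {X : C} {k : K} (x : X ≅ B.δ k) :
    B.IsScalar (B.map (φ := φ q) (θ q) (B.map (φ := φ q') (θ q') x))
      (B.map (φ := φ (q * q')) (θ (q * q')) x) (η k q q') (T.actMul q q' X) := by
  have h₁ := IsScalar.app (F := (T.act q').functor ⋙ (T.act q).functor)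
    (φ := fun k => φ q (φ q' k)) (θ := fun k => B.map (φ := φ q) (θ q) (θ q' k))
    (ψ := φ (q * q')) (θ' := θ (q * q'))
    (α := (TensorAut.Hom.iso (μ T.toFunctor (Discrete.mk q) (Discrete.mk q'))).hom)
    (h.mul q q' k) x
  rwa [map_comp] at h₁

lemma hom_ext {f g : T ⟶ T'} {c : Q → K → ℂ}
    (hf : ∀ q k, B.IsScalar (θ q k) (θ' q k) (c q k) ((f.hom.app ⟨q⟩).iso.hom.app (B.δ k)))
    (hg : ∀ q k, B.IsScalar (θ q k) (θ' q k) (c q k) ((g.hom.app ⟨q⟩).iso.hom.app (B.δ k))) :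
    f = g := by
  ext ⟨q⟩ : 3
  exact B.tensorAut_hom_ext fun k => (hf q k).hom_ext (hg q k) rfl

lemma mul_comp (h : B.Scalars φ T θ ω η) {q q' : Q} {α : T.act (q * q') ⟶ T'.act (q * q')}
    {c : ℂ} {k : K} (hα : B.IsScalar (θ (q * q') k) (θ' (q * q') k) c (α.iso.hom.app (B.δ k))) :
    B.IsScalar (B.map (φ := φ q) (θ q) (θ q' k)) (θ' (q * q') k) (η k q q' * c)
      (TensorAut.Hom.iso (μ T.toFunctor (Discrete.mk q) (Discrete.mk q') ≫ α)|>.hom.app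
        (B.δ k)) :=
  (h.mul q q' k).comp hα

lemma comp_mul (h : B.Scalars φ T' θ' ω' η') {q q' : Q} {α : T.act q ⟶ T'.act q}
    {β : T.act q' ⟶ T'.act q'} {k : K} {c d : ℂ}
    (hα : B.IsScalar (θ q (φ q' k)) (θ' q (φ q' k)) c (α.iso.hom.app (B.δ (φ q' k))))
    (hβ : B.IsScalar (θ q' k) (θ' q' k) d (β.iso.hom.app (B.δ k))) :
    B.IsScalar (B.map (φ := φ q) (θ q) (θ q' k)) (θ' (q * q') k) (c * d * η' k q q')
      (TensorAut.Hom.iso ((α ⊗ₘ β) ≫ μ T'.toFunctor (Discrete.mk q) (Discrete.mk q'))|>.hom.app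
        (B.δ k)) :=
  ((hα.app (φ := φ q) (ψ := φ q) (θ q' k)).comp
    (hβ.map (F := (T'.act q).functor) (φ := φ q) (θ' q))).comp (h.mul q q' k)

variable [MonoidalPreadditive C] [MonoidalLinear ℂ C]

lemma _root_.VecActions.PointedBasis.TensorScalars.exists_hom {F G : TensorAut C} {φ ψ : K → K}
    {θ : ∀ k, F.functor.obj (B.δ k) ≅ B.δ (φ k)} {θ' : ∀ k, G.functor.obj (B.δ k) ≅ B.δ (ψ k)}
    {ω ω' : K → K → ℂˣ} (h : B.TensorScalars F θ ω) (h' : B.TensorScalars G θ' ω')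
    (hφ : ∀ k, φ k = ψ k) (c : K → ℂˣ) (hc : ∀ k l, ω k l * c (k * l) = c k * c l * ω' k l) :
    ∃ α : F ⟶ G, ∀ k, B.IsScalar (θ k) (θ' k) (c k) (α.iso.hom.app (B.δ k)) := by
  have hα k := IsScalar.exists_iso (θ k) (θ' k) (hφ k) (c k)
  choose α hα using hα
  obtain ⟨β, hβ⟩ := B.exists_natIso F.functor G.functor α
  simp only [← hβ] at hα
  exact ⟨⟨β, (B.isMonoidal_of_scalar β.hom hα h h').2 hc⟩, hα⟩

/-- Each field compares the scalars of the two sides of one axiom: `dk` of associativity for the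
tensor structure of `T_q`, `mixed` of monoidality of `T_q T_{q'} ⟶ T_{qq'}`, `dq` of associativity
of the action. -/
lemma isCocycleOver (h : B.Scalars φ T θ ω η) : IsCocycleOver φ ω η where
  dk q k l m := by
    have h₁ {X Y : C} {k l : K} (x : X ≅ B.δ k) (y : Y ≅ B.δ l) := (h.tensor q k l).tensorator x y
    let x := Iso.refl (B.δ k)
    let y := Iso.refl (B.δ l)
    let z := Iso.refl (B.δ m)
    have h₂ := ((h₁ x y).whiskerRight (B.map (φ := φ q) (θ q) z)).comp
      ((h₁ (B.tensor x y) z).comp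
        ((IsScalar.associator x y z).map (F := (T.act q).functor) (φ := φ q) (θ q)))
    rw [associativity] at h₂
    have h₃ := h₂.unique ((IsScalar.associator _ _ _).comp
      (((h₁ y z).whiskerLeft (B.map (φ := φ q) (θ q) x)).comp (h₁ x (B.tensor y z))))
    ext
    push_cast
    linear_combination -h₃
  mixed q q' k l := by
    have := ((B.isMonoidal_of_scalar _ (h.mul q q') ((h.tensor q').comp (h.tensor q))
      (h.tensor (q * q'))).1 (TensorAut.Hom.isMonoidal _)) k l
    exact this
  dq k q q' q'' := by
    have h₁ := (h.mul_app q q' (θ q'' k)).comp ((h.mul (q * q') q'' k).comp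
      (B.isScalar_map T.toFunctor θ (α_ (Discrete.mk q) (Discrete.mk q') (Discrete.mk q'')).hom k))
    have h₂ := ((h.mul q' q'' k).map (F := (T.act q).functor) (φ := φ q) (θ q)).comp
      (h.mul q (q' * q'') k)
    rw [TensorAction.actMul_assoc] at h₁
    ext
    simpa using h₁.unique h₂

/-- The field `left` expresses that each component of `f` is monoidal, `right` that `f` respects the
structure maps of the actions. -/
lemma exists_isRelatedBy (h : B.Scalars φ T θ ω η) (h' : B.Scalars φ T' θ' ω' η') (f : T ⟶ T') :
    ∃ c, (∀ q k, B.IsScalar (θ q k) (θ' q k) (c q k : ℂˣ)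
      ((f.hom.app ⟨q⟩).iso.hom.app (B.δ k))) ∧ IsRelatedBy φ c ω η ω' η' := by
  have h₁ q k := IsScalar.exists_unit (θ q k) (θ' q k) rfl
    ((f.hom.app ⟨q⟩).iso.hom.app (B.δ k))
  choose c hc using h₁
  refine ⟨c, hc, fun q => ?_, fun q q' k => ?_⟩
  · exact (B.isMonoidal_of_scalar _ (hc q) (h.tensor q) (h'.tensor q)).1
      (TensorAut.Hom.isMonoidal _)
  · have h₁ := h.mul_comp (hc (q * q') k)
    have h₂ := h'.comp_mul (hc q (φ q' k)) (hc q' k)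
    have h₃ := congrArg (fun α => (TensorAut.Hom.iso α).hom.app (B.δ k))
      (f.isMonoidal.tensor (Discrete.mk q) (Discrete.mk q'))
    ext
    simpa using h₁.unique (h₂.congr h₃.symm)

lemma exists_hom (h : B.Scalars φ T θ ω η) (h' : B.Scalars φ T' θ' ω' η') {c : Q → K → ℂˣ}
    (hc : IsRelatedBy φ c ω η ω' η') :
    ∃ f : T ⟶ T', ∀ q k, B.IsScalar (θ q k) (θ' q k) (c q k)
      ((f.hom.app ⟨q⟩).iso.hom.app (B.δ k)) := by
  have h₁ q := (h.tensor q).exists_hom (h'.tensor q) (fun _ => rfl) (c q) (hc.left q)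
  choose α hα using h₁
  let β : T.toFunctor ⟶ T'.toFunctor := Discrete.natTrans fun q => α q.as
  have h₂ (q q' : Q) : μ T.toFunctor (Discrete.mk q) (Discrete.mk q') ≫
      β.app (Discrete.mk q ⊗ Discrete.mk q') =
      (β.app (Discrete.mk q) ⊗ₘ β.app (Discrete.mk q')) ≫
        μ T'.toFunctor (Discrete.mk q) (Discrete.mk q') := by
    refine B.tensorAut_hom_ext fun k => ?_
    refine (h.mul_comp (hα (q * q') k)).hom_ext (h'.comp_mul (hα q (φ q' k)) (hα q' k)) ?_
    exact_mod_cast hc.right q q' k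
  -- All morphisms of `TensorAut C` are invertible, so the unit condition follows from the tensor
  -- condition at `1`.
  exact ⟨⟨β, unit_of_tensor β (h₂ 1 1), fun q q' => h₂ q.as q'.as⟩, hα⟩

end Scalars

end PointedBasis

/-! ### Realizing cocycles by actions -/

namespace PointedBasis

variable {K : Type u} [Group K] {C : Type v} [Category.{w} C] [MonoidalCategory C]
  [Preadditive C] [Linear ℂ C] (B : PointedBasis K C)

/-- Over the trivial homomorphism, all isomorphism classes are fixed. -/
lemma fixesIsoClasses_of_simple (F : TensorAut C) (θ : ∀ k, F.functor.obj (B.δ k) ≅ B.δ k) :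
    fixesIsoClasses C F := by
  obtain ⟨β, -⟩ := B.exists_natIso F.functor (𝟭 C) θ
  exact fun X => ⟨β.app X⟩

variable [MonoidalPreadditive C] [MonoidalLinear ℂ C] {Q : Type*} [Group Q]
  {φ : Q →* MulAut K}

/-- Every cocycle is realized by an action. -/
lemma exists_action (R : Q → C ⥤ C) [∀ q, (R q).Additive] [∀ q, (R q).Linear ℂ]
    [∀ q, (R q).IsEquivalence] (θ : ∀ q k, (R q).obj (B.δ k) ≅ B.δ (φ q k))
    {ω : Q → K → K → ℂˣ} {η : K → Q → Q → ℂˣ} (h : IsCocycleOver φ ω η) :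
    ∃ (T : TensorAction C Q) (θ : _), B.Scalars φ T θ ω η := by
  -- Here `h.dk` makes `R q` monoidal; next, `h.mixed` makes the maps with scalars `η` monoidal, and
  -- `h.dq` later gives their associativity.
  choose M hM using fun q => B.exists_monoidal (φ q : K →* K) (R q) (θ q) (ω q) (h.dk q)
  let A q : TensorAut C := ⟨R q, M q, inferInstance, inferInstance, inferInstance⟩
  have hA q : B.TensorScalars (A q) (φ := φ q) (θ q) (ω q) := hM q
  choose m hm using fun q q' => ((hA q').comp (hA q)).exists_hom (hA (q * q'))
    (fun k => by rw [map_mul, MulAut.mul_apply]) (fun k => η k q q') (h.mixed q q')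
  have hm' (q q' : Q) {X : C} {k : K} (x : X ≅ B.δ k) :
      B.IsScalar (B.map (φ := φ q) (θ q) (B.map (φ := φ q') (θ q') x))
        (B.map (φ := φ (q * q')) (θ (q * q')) x) (η k q q')
        ((TensorAut.Hom.iso (m q q')).hom.app X) := by
    have h₁ := IsScalar.app (F := R q' ⋙ R q) (φ := fun k => φ q (φ q' k))
      (θ := fun k => B.map (φ := φ q) (θ q) (θ q' k)) (ψ := φ (q * q')) (θ' := θ (q * q'))
      (α := (TensorAut.Hom.iso (m q q')).hom) (hm q q' k) x
    rwa [map_comp] at h₁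
  -- The unit `𝟭 ⟶ T_1` has scalar `(η k 1 1)⁻¹`. Of these degenerate cases of the cocycle
  -- equations, `hη₁` and `hη₂` give its left and right unit laws, and `hω` its monoidality.
  have hη₁ (q : Q) (k : K) : η (φ q k) 1 1 = η k 1 q := by simpa using h.dq k 1 1 q
  have hη₂ (q : Q) (k : K) : η k q 1 = η k 1 1 := by simpa using h.dq k q 1 1
  have hω (k l : K) : ω 1 k l * η (k * l) 1 1 = η k 1 1 * η l 1 1 := by
    have := h.mixed 1 1 k l
    simp only [map_one, MulAut.one_apply, mul_one] at this
    rw [mul_comm (η k 1 1 * _), mul_assoc] at this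
    exact mul_left_cancel this
  obtain ⟨e, he⟩ := B.tensorScalars_unit.exists_hom (hA 1) (fun k => by simp)
    (fun k => (η k 1 1)⁻¹) (fun k l => by
      rw [one_mul, ← mul_inv, ← hω, mul_inv, mul_comm, mul_inv_cancel_left])
  have he' k : B.IsScalar (Iso.refl (B.δ k)) (θ 1 k) ((η k 1 1)⁻¹ : ℂˣ)
    ((TensorAut.Hom.iso e).hom.app (B.δ k)) := he k
  let T : Discrete Q ⥤ TensorAut C := Discrete.functor A
  let L : T.LaxMonoidal :=
    { ε := e
      μ q q' := m q.as q'.as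
      μ_natural_left := by
        rintro ⟨q⟩ ⟨q'⟩ f ⟨q''⟩
        obtain rfl : q = q' := Discrete.eq_of_hom f
        obtain rfl : f = 𝟙 _ := Subsingleton.elim _ _
        simp
      μ_natural_right := by
        rintro ⟨q⟩ ⟨q'⟩ ⟨q''⟩ f
        obtain rfl : q = q' := Discrete.eq_of_hom f
        obtain rfl : f = 𝟙 _ := Subsingleton.elim _ _
        simp
      associativity := by
        rintro ⟨q⟩ ⟨q'⟩ ⟨q''⟩
        refine B.tensorAut_hom_ext fun k => ?_
        have h₁ := (hm' q q' (θ q'' k)).comp ((hm (q * q') q'' k).comp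
          (B.isScalar_map T θ (α_ (Discrete.mk q) (Discrete.mk q') (Discrete.mk q'')).hom k))
        have h₂ := (IsScalar.id _).comp (((hm q' q'' k).map (F := R q) (φ := φ q) (θ q)).comp
          (hm q (q' * q'') k))
        refine h₁.hom_ext h₂ ?_
        simpa using congrArg Units.val (h.dq k q q' q'')
      left_unitality := by
        rintro ⟨q⟩
        refine B.tensorAut_hom_ext fun k => ?_
        have h₁ := (IsScalar.app (F := 𝟭 C) (θ := fun k => Iso.refl (B.δ k))
          (G := R 1) (ψ := φ 1) (θ' := θ 1) (φ := fun k => k) (α := (TensorAut.Hom.iso e).hom)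
          (he' (φ q k)) (θ q k)).comp ((hm 1 q k).comp
          (B.isScalar_map T θ (λ_ (Discrete.mk q)).hom k))
        have h₂ : B.map (F := 𝟭 C) (fun k => Iso.refl (B.δ k)) (θ q k) = θ q k := by
          ext; simp [map]
        rw [h₂] at h₁
        refine (IsScalar.id _).hom_ext h₁ ?_
        simp [hη₁]
      right_unitality := by
        rintro ⟨q⟩
        refine B.tensorAut_hom_ext fun k => ?_
        have h₁ := ((he' k).map (F := R q) (φ := φ q) (θ q)).comp ((hm q 1 k).comp
          (B.isScalar_map T θ (ρ_ (Discrete.mk q)).hom k))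
        rw [map_refl] at h₁
        refine (IsScalar.id _).hom_ext h₁ ?_
        simp [hη₂] }
  exact ⟨⟨T, L⟩, θ, hA, hm⟩

end PointedBasis

/-! ### General facts used for `Vec_K` -/

lemma Generates.of_fintype {C : Type*} [Category* C] [Preadditive C] {I : Type u} {δ : I → C}
    (h : ∀ X : C, ∃ (A : Type u) (_ : Fintype A) (k : A → I) (p : ∀ a, X ⟶ δ (k a))
      (i : ∀ a, δ (k a) ⟶ X), ∑ a, p a ≫ i a = 𝟙 X) : Generates δ := by
  intro X
  obtain ⟨A, _, k, p, i, hX⟩ := h X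
  let e := (Fintype.equivFin A).symm
  exact ⟨_, fun a => k (e a), fun a => p (e a), fun a => i (e a),
    (Equiv.sum_comp e fun a => p a ≫ i a).trans hX⟩

/-- This evaluates the associativity square `h` on a tensor product of three points, which is the
form that remains when `deltaComul_coassoc` is tested on the generator of `δ_{klm}`. -/
lemma tensor_points_assoc {C : Type*} [Category* C] [MonoidalCategory C]
    {X Y Z XY YZ T T' : C} (x : 𝟙_ C ⟶ X) (y : 𝟙_ C ⟶ Y) (z : 𝟙_ C ⟶ Z) (f : X ⊗ Y ⟶ XY)
    (g : XY ⊗ Z ⟶ T) (t : T ⟶ T') (f' : Y ⊗ Z ⟶ YZ) (g' : X ⊗ YZ ⟶ T')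
    (h : f ▷ Z ≫ g ≫ t = (α_ X Y Z).hom ≫ X ◁ f' ≫ g') :
    (λ_ (𝟙_ C)).inv ≫ (((λ_ (𝟙_ C)).inv ≫ (x ⊗ₘ y) ≫ f) ⊗ₘ z) ≫ g ≫ t =
      (λ_ (𝟙_ C)).inv ≫ (x ⊗ₘ ((λ_ (𝟙_ C)).inv ≫ (y ⊗ₘ z) ≫ f')) ≫ g' := by
  have h₁ : (((λ_ (𝟙_ C)).inv ≫ (x ⊗ₘ y) ≫ f) ⊗ₘ z) =
      (λ_ (𝟙_ C)).inv ▷ 𝟙_ C ≫ ((x ⊗ₘ y) ⊗ₘ z) ≫ f ▷ Z := by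
    rw [← tensorHom_id, ← tensorHom_id, MonoidalCategory.tensorHom_comp_tensorHom,
      MonoidalCategory.tensorHom_comp_tensorHom, Category.comp_id, Category.id_comp]
  have h₂ : (x ⊗ₘ ((λ_ (𝟙_ C)).inv ≫ (y ⊗ₘ z) ≫ f')) =
      𝟙_ C ◁ (λ_ (𝟙_ C)).inv ≫ (x ⊗ₘ (y ⊗ₘ z)) ≫ X ◁ f' := by
    rw [← id_tensorHom, ← id_tensorHom, MonoidalCategory.tensorHom_comp_tensorHom,
      MonoidalCategory.tensorHom_comp_tensorHom, Category.comp_id, Category.id_comp]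
  have h₃ : (λ_ (𝟙_ C)).inv ≫ (λ_ (𝟙_ C)).inv ▷ 𝟙_ C ≫ (α_ _ _ _).hom =
      (λ_ (𝟙_ C)).inv ≫ 𝟙_ C ◁ (λ_ (𝟙_ C)).inv := by monoidal
  rw [h₁, h₂]
  simp only [Category.assoc]
  rw [h, associator_naturality_assoc, reassoc_of% h₃]

/-! ### The category `Vec_K` -/

section VecCat

open GradedObject

variable {K : Type u}

section Monoidal

variable [Group K] [Finite K]

/-- The inclusion of a summand of a tensor product. -/
noncomputable def tensorι (X Y : VecCat K) (i j n : Additive K) (h : i + j = n) :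
    X i ⊗ Y j ⟶ (X ⊗ Y) n :=
  Monoidal.ιTensorObj X Y i j n h

lemma tensorι_hom_ext {X Y : VecCat K} {n : Additive K} {Z : FGModuleCat.{0} ℂ}
    {f g : (X ⊗ Y) n ⟶ Z}
    (h : ∀ i j hij, tensorι X Y i j n hij ≫ f = tensorι X Y i j n hij ≫ g) : f = g :=
  Monoidal.tensorObj_ext _ _ h

lemma tensorι_whiskerRight {X X' : VecCat K} (f : X ⟶ X') (Y : VecCat K) (i j n : Additive K)
    (h : i + j = n) :
    tensorι X Y i j n h ≫ (f ▷ Y) n = f i ▷ Y j ≫ tensorι X' Y i j n h := by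
  rw [← tensorHom_id]
  exact Monoidal.ι_tensorHom f (𝟙 Y) i j n h

lemma tensorι_whiskerLeft (X : VecCat K) {Y Y' : VecCat K} (f : Y ⟶ Y') (i j n : Additive K)
    (h : i + j = n) :
    tensorι X Y i j n h ≫ (X ◁ f) n = X i ◁ f j ≫ tensorι X Y' i j n h := by
  rw [← id_tensorHom]
  exact Monoidal.ι_tensorHom (𝟙 X) f i j n h

lemma tensorι_associator (X Y Z : VecCat K) (i j l ij jl n : Additive K) (hij : i + j = ij)
    (hjl : j + l = jl) (h : ij + l = n) (h' : i + jl = n) :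
    tensorι X Y i j ij hij ▷ Z l ≫ tensorι (X ⊗ Y) Z ij l n h ≫ (α_ X Y Z).hom n =
      (α_ (X i) (Y j) (Z l)).hom ≫ X i ◁ tensorι Y Z j l jl hjl ≫
        tensorι X (Y ⊗ Z) i jl n h' := by
  subst hij hjl
  have := Monoidal.ιTensorObj₃'_associator_hom X Y Z i j l n h
  simp only [Monoidal.ιTensorObj₃', Monoidal.ιTensorObj₃, Category.assoc] at this
  exact this

instance : MonoidalPreadditive (VecCat K) where
  whiskerLeft_zero := by
    intro X Y Z
    funext n
    refine tensorι_hom_ext fun i j h => ?_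
    rw [tensorι_whiskerLeft]
    exact (congrArg (· ≫ _) MonoidalPreadditive.whiskerLeft_zero).trans
      (Limits.zero_comp.trans Limits.comp_zero.symm)
  zero_whiskerRight := by
    intro X Y Z
    funext n
    refine tensorι_hom_ext fun i j h => ?_
    rw [tensorι_whiskerRight]
    exact (congrArg (· ≫ _) MonoidalPreadditive.zero_whiskerRight).trans
      (Limits.zero_comp.trans Limits.comp_zero.symm)
  whiskerLeft_add := by
    intro X Y Z f g
    funext n
    refine tensorι_hom_ext fun i j h => ?_
    refine Eq.trans ?_ (Preadditive.comp_add _ _ _ _ ((X ◁ f) n) ((X ◁ g) n)).symm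
    rw [tensorι_whiskerLeft, tensorι_whiskerLeft, tensorι_whiskerLeft, ← Preadditive.add_comp]
    exact congrArg (· ≫ _) (MonoidalPreadditive.whiskerLeft_add (f j) (g j))
  add_whiskerRight := by
    intro X Y Z f g
    funext n
    refine tensorι_hom_ext fun i j h => ?_
    refine Eq.trans ?_ (Preadditive.comp_add _ _ _ _ ((f ▷ X) n) ((g ▷ X) n)).symm
    rw [tensorι_whiskerRight, tensorι_whiskerRight, tensorι_whiskerRight, ← Preadditive.add_comp]
    exact congrArg (· ≫ _) (MonoidalPreadditive.add_whiskerRight (f i) (g i))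

instance : MonoidalLinear ℂ (VecCat K) where
  whiskerLeft_smul := by
    intro X Y Z r f
    funext n
    refine tensorι_hom_ext fun i j h => ?_
    refine Eq.trans ?_ (Linear.comp_smul _ _ _ _ r ((X ◁ f) n)).symm
    rw [tensorι_whiskerLeft, tensorι_whiskerLeft, ← Linear.smul_comp]
    exact congrArg (· ≫ _) (MonoidalLinear.whiskerLeft_smul (X i) r (f j))
  smul_whiskerRight := by
    intro r Y Z f X
    funext n
    refine tensorι_hom_ext fun i j h => ?_
    refine Eq.trans ?_ (Linear.comp_smul _ _ _ _ r ((f ▷ X) n)).symm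
    rw [tensorι_whiskerRight, tensorι_whiskerRight, ← Linear.smul_comp]
    exact congrArg (· ≫ _) (MonoidalLinear.smul_whiskerRight r (f i) (X j))

end Monoidal

/-! ### Morphisms between simple objects -/

open scoped Classical in
/-- Away from degree `k`, the object `δ_k` vanishes. -/
noncomputable def deltaIsInitial (k : K) (i : Additive K) (h : i ≠ Additive.ofMul k) :
    Limits.IsInitial (delta k i) :=
  isInitialSingleObjApply (Additive.ofMul k) _ i h

lemma delta_hom_ext {k : K} {X : VecCat K} {f g : delta k ⟶ X}
    (h : (deltaIso k _ rfl).inv ≫ f (Additive.ofMul k) =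
      (deltaIso k _ rfl).inv ≫ g (Additive.ofMul k)) : f = g := by
  funext i
  by_cases hi : i = Additive.ofMul k
  · subst hi
    exact (cancel_epi _).1 h
  · exact (deltaIsInitial k i hi).hom_ext _ _

open scoped Classical in
/-- A morphism from `δ_k` is determined by an element in degree `k`. -/
noncomputable def deltaDesc {k : K} {X : VecCat K}
    (f : 𝟙_ (FGModuleCat.{0} ℂ) ⟶ X (Additive.ofMul k)) : delta k ⟶ X :=
  fun i => if h : i = Additive.ofMul k then (deltaIso k i h).hom ≫ f ≫ eqToHom (by rw [h])
    else (deltaIsInitial k i h).to _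

lemma deltaIso_inv_deltaDesc {k : K} {X : VecCat K}
    (f : 𝟙_ (FGModuleCat.{0} ℂ) ⟶ X (Additive.ofMul k)) :
    (deltaIso k _ rfl).inv ≫ deltaDesc f (Additive.ofMul k) = f := by
  simp [deltaDesc]

lemma deltaIso_inv_eqToHom {k k' : K} (h : k = k') {i : Additive K} (hi : i = Additive.ofMul k) :
    (deltaIso k i hi).inv ≫ (eqToHom (congrArg delta h) : delta k ⟶ delta k') i =
      (deltaIso k' i (by rw [hi, h])).inv := by
  subst h
  exact Category.comp_id _

open scoped Classical in
/-- A morphism to `δ_k` from a linear form in degree `k`. -/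
noncomputable def deltaLift {k : K} {X : VecCat K}
    (f : X (Additive.ofMul k) ⟶ 𝟙_ (FGModuleCat.{0} ℂ)) : X ⟶ delta k :=
  fun i => if h : i = Additive.ofMul k then eqToHom (by rw [h]) ≫ f ≫ (deltaIso k i h).inv
    else 0

lemma deltaLift_deltaDesc {k : K} {X Y : VecCat K}
    (f : X (Additive.ofMul k) ⟶ 𝟙_ (FGModuleCat.{0} ℂ))
    (g : 𝟙_ (FGModuleCat.{0} ℂ) ⟶ Y (Additive.ofMul k)) :
    (deltaLift f ≫ deltaDesc g) (Additive.ofMul k) = f ≫ g := by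
  change deltaLift f _ ≫ deltaDesc g _ = _
  simp [deltaDesc, deltaLift]

lemma deltaLift_deltaDesc_of_ne {k : K} {X Y : VecCat K}
    (f : X (Additive.ofMul k) ⟶ 𝟙_ (FGModuleCat.{0} ℂ))
    (g : 𝟙_ (FGModuleCat.{0} ℂ) ⟶ Y (Additive.ofMul k)) (i : Additive K)
    (h : i ≠ Additive.ofMul k) : (deltaLift f ≫ deltaDesc g) i = 0 := by
  change deltaLift f _ ≫ deltaDesc g _ = _
  simp [deltaLift, h]

lemma unit_scalar (f : 𝟙_ (FGModuleCat.{0} ℂ) ⟶ 𝟙_ (FGModuleCat.{0} ℂ)) :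
    ∃ c : ℂ, f = c • 𝟙 _ := by
  let g : ℂ →ₗ[ℂ] ℂ := f.hom.hom
  refine ⟨g 1, FGModuleCat.hom_ext (LinearMap.ext_ring ?_)⟩
  change g 1 = g 1 • (1 : ℂ)
  simp

lemma unit_id_ne_zero : 𝟙 (𝟙_ (FGModuleCat.{0} ℂ)) ≠ 0 := by
  intro h
  have h₁ : (1 : ℂ) = 0 := congrArg (fun f : 𝟙_ (FGModuleCat.{0} ℂ) ⟶ 𝟙_ _ =>
    (show ℂ →ₗ[ℂ] ℂ from f.hom.hom) (1 : ℂ)) h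
  exact one_ne_zero h₁

lemma exists_decomposition (V : FGModuleCat.{0} ℂ) :
    ∃ (n : ℕ) (p : Fin n → (V ⟶ 𝟙_ (FGModuleCat.{0} ℂ)))
      (i : Fin n → (𝟙_ (FGModuleCat.{0} ℂ) ⟶ V)), ∑ a, p a ≫ i a = 𝟙 V := by
  let b := Module.finBasis ℂ V
  refine ⟨_, fun a => FGModuleCat.ofHom (b.coord a),
    fun a => FGModuleCat.ofHom (LinearMap.toSpanSingleton ℂ V (b a)), ?_⟩
  refine FGModuleCat.hom_ext (LinearMap.ext fun v => ?_)
  let ev : (V ⟶ V) →+ V := ⟨⟨fun f => f.hom.hom v, rfl⟩, fun _ _ => rfl⟩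
  refine (map_sum ev _ _).trans ?_
  exact b.sum_repr v

lemma delta_scalar (k : K) (f : delta k ⟶ delta k) : ∃ c : ℂ, f = c • 𝟙 _ := by
  obtain ⟨c, hc⟩ := unit_scalar ((deltaIso k _ rfl).inv ≫ f (Additive.ofMul k) ≫
    (deltaIso k _ rfl).hom)
  refine ⟨c, delta_hom_ext ?_⟩
  change _ = _ ≫ (c • 𝟙 (delta k (Additive.ofMul k)))
  rw [← cancel_mono (deltaIso k _ rfl).hom, Category.assoc, hc]
  simp

lemma delta_id_ne_zero (k : K) : 𝟙 (delta k) ≠ 0 := by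
  intro h
  have h₁ : 𝟙 (delta k (Additive.ofMul k)) = 0 := congrFun h _
  apply unit_id_ne_zero
  rw [← (deltaIso k _ rfl).inv_hom_id, ← Category.id_comp (deltaIso k _ rfl).hom, h₁]
  simp

lemma delta_hom_eq_zero (k l : K) (h : k ≠ l) (f : delta k ⟶ delta l) : f = 0 := by
  funext i
  by_cases hi : i = Additive.ofMul k
  · have : Limits.IsZero (delta l i) := by
      rw [Limits.IsZero.iff_id_eq_zero]
      exact (deltaIsInitial l i fun h' => h (hi.symm.trans h')).hom_ext _ _
    exact this.eq_of_tgt _ _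
  · exact (deltaIsInitial k i hi).hom_ext _ _

lemma delta_generates [Finite K] : Generates (delta (K := K)) := by
  have := Fintype.ofFinite K
  refine .of_fintype fun X => ?_
  choose n p i h using fun k : K => exists_decomposition (X (Additive.ofMul k))
  -- One summand for each basis vector of each homogeneous part; in degree `j` only those with `k =
  -- j` survive. `ULift` moves the index type to the universe of `K`.
  refine ⟨Σ k, ULift (Fin (n k)), inferInstance, fun a => a.1, fun a => deltaLift (p a.1 a.2.down),
    fun a => deltaDesc (i a.1 a.2.down), ?_⟩
  funext j
  let ev : (X ⟶ X) →+ (X j ⟶ X j) := ⟨⟨fun f => f j, rfl⟩, fun _ _ => rfl⟩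
  refine (map_sum ev _ _).trans ?_
  rw [Fintype.sum_sigma, Fintype.sum_eq_single (Additive.toMul j)]
  · refine Eq.trans ?_ ((Equiv.ulift.{u}.sum_comp fun a => p (Additive.toMul j) a ≫
      i (Additive.toMul j) a).trans (h (Additive.toMul j)))
    exact Finset.sum_congr rfl fun a _ => deltaLift_deltaDesc (X := X) (Y := X)
      (p (Additive.toMul j) a.down) (i (Additive.toMul j) a.down)
  · intro k hk
    exact Finset.sum_eq_zero fun a _ => deltaLift_deltaDesc_of_ne _ _ _ fun h => hk h.symm

/-! ### The multiplication of simple objects -/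

section Multiplication

variable [Group K] [Finite K]

/-- The inverse of `δ_k ⊗ δ_l ⟶ δ_{kl}`. -/
noncomputable def deltaComul (k l : K) : delta (k * l) ⟶ delta k ⊗ delta l :=
  deltaDesc ((λ_ _).inv ≫ ((deltaIso k _ rfl).inv ⊗ₘ (deltaIso l _ rfl).inv) ≫
    tensorι (delta k) (delta l) (Additive.ofMul k) (Additive.ofMul l)
        (Additive.ofMul (k * l)) rfl)

lemma deltaIso_inv_deltaComul (k l : K) :
    (deltaIso (k * l) _ rfl).inv ≫ deltaComul k l (Additive.ofMul (k * l)) =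
      (λ_ _).inv ≫ ((deltaIso k _ rfl).inv ⊗ₘ (deltaIso l _ rfl).inv) ≫
        tensorι (delta k) (delta l) (Additive.ofMul k) (Additive.ofMul l)
        (Additive.ofMul (k * l)) rfl :=
  deltaIso_inv_deltaDesc _

lemma tensorι_deltaMul (k l : K) :
    tensorι (delta k) (delta l) (Additive.ofMul k) (Additive.ofMul l)
        (Additive.ofMul (k * l)) rfl ≫
        deltaMul k l (Additive.ofMul (k * l)) =
      ((deltaIso k _ rfl).hom ⊗ₘ (deltaIso l _ rfl).hom) ≫ (λ_ _).hom ≫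
        (deltaIso (k * l) _ rfl).inv := by
  refine (Monoidal.ι_tensorObjDesc _ _ _ _).trans ?_
  rw [dif_pos ⟨rfl, rfl⟩]

/-- The other summands of the tensor product have a factor that vanishes, so their identities are
zero. -/
lemma tensor_delta_hom_ext {k l : K} {X : VecCat K} {f g : delta k ⊗ delta l ⟶ X}
    (h : tensorι (delta k) (delta l) (Additive.ofMul k) (Additive.ofMul l)
        (Additive.ofMul (k * l)) rfl ≫
        f (Additive.ofMul (k * l)) =
      tensorι (delta k) (delta l) (Additive.ofMul k) (Additive.ofMul l)
        (Additive.ofMul (k * l)) rfl ≫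
        g (Additive.ofMul (k * l))) : f = g := by
  funext n
  refine tensorι_hom_ext fun i j hij => ?_
  have hz (k : K) (i : Additive K) (hi : i ≠ Additive.ofMul k) : 𝟙 (delta k i) = 0 :=
    (deltaIsInitial k i hi).hom_ext _ _
  by_cases hi : i = Additive.ofMul k
  · by_cases hj : j = Additive.ofMul l
    · subst hi hj hij
      exact h
    · have h₁ : 𝟙 (delta k i ⊗ delta l j) = 0 := by
        rw [← MonoidalCategory.whiskerLeft_id, hz l j hj, MonoidalPreadditive.whiskerLeft_zero]
      rw [← Category.id_comp (tensorι _ _ _ _ _ _), h₁, Limits.zero_comp, Limits.zero_comp,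
        Limits.zero_comp]
  · have h₁ : 𝟙 (delta k i ⊗ delta l j) = 0 := by
      rw [← id_whiskerRight, hz k i hi, MonoidalPreadditive.zero_whiskerRight]
    rw [← Category.id_comp (tensorι _ _ _ _ _ _), h₁, Limits.zero_comp, Limits.zero_comp,
      Limits.zero_comp]

/-- The isomorphism `δ_k ⊗ δ_l ≅ δ_{kl}`. -/
noncomputable def deltaMulIso (k l : K) : delta k ⊗ delta l ≅ delta (k * l) where
  hom := deltaMul k l
  inv := deltaComul k l
  hom_inv_id := by
    refine tensor_delta_hom_ext ?_
    rw [categoryOfGradedObjects_comp, reassoc_of% tensorι_deltaMul, deltaIso_inv_deltaComul,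
      Iso.hom_inv_id_assoc, MonoidalCategory.tensorHom_comp_tensorHom_assoc, Iso.hom_inv_id,
      Iso.hom_inv_id, id_tensorHom_id, Category.id_comp]
    exact (Category.comp_id _).symm
  inv_hom_id := by
    refine delta_hom_ext ?_
    rw [categoryOfGradedObjects_comp, reassoc_of% deltaIso_inv_deltaComul, tensorι_deltaMul,
      MonoidalCategory.tensorHom_comp_tensorHom_assoc, Iso.inv_hom_id, Iso.inv_hom_id,
      id_tensorHom_id, Category.id_comp, Iso.inv_hom_id_assoc]
    exact (Category.comp_id _).symm

lemma deltaIso_inv_deltaComul' (k l : K) {n : Additive K} (h : n = Additive.ofMul (k * l)) :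
    (deltaIso (k * l) n h).inv ≫ deltaComul k l n =
      (λ_ _).inv ≫ ((deltaIso k _ rfl).inv ⊗ₘ (deltaIso l _ rfl).inv) ≫
        tensorι (delta k) (delta l) (Additive.ofMul k) (Additive.ofMul l) n h.symm := by
  subst h
  exact deltaIso_inv_deltaComul k l

/-- The comultiplication is easier than the multiplication: its source is a single simple object, so
both sides are determined by one point. Inverting gives the associativity needed in `deltaBasis`. -/
lemma deltaComul_coassoc (k l m : K) :
    deltaComul (k * l) m ≫ deltaComul k l ▷ delta m ≫ (α_ _ _ _).hom =
      eqToHom (congrArg delta (mul_assoc k l m)) ≫ deltaComul k (l * m) ≫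
        delta k ◁ deltaComul l m := by
  refine delta_hom_ext ?_
  rw [categoryOfGradedObjects_comp, categoryOfGradedObjects_comp, categoryOfGradedObjects_comp,
    categoryOfGradedObjects_comp]
  rw [reassoc_of% deltaIso_inv_deltaComul, reassoc_of% (deltaIso_inv_eqToHom (mul_assoc k l m)),
    reassoc_of% deltaIso_inv_deltaComul', reassoc_of% tensorι_whiskerRight, tensorι_whiskerLeft,
    ← tensorHom_id, ← id_tensorHom, MonoidalCategory.tensorHom_comp_tensorHom_assoc,
    MonoidalCategory.tensorHom_comp_tensorHom_assoc, deltaIso_inv_deltaComul,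
    deltaIso_inv_deltaComul, Category.comp_id, Category.comp_id]
  exact tensor_points_assoc _ _ _ _ _ _ _ _ (tensorι_associator _ _ _ _ _ _ _ _ _ _ _ _ _)

/-- The unit of `Vec_K` is `δ_1`. -/
noncomputable def deltaUnit : 𝟙_ (VecCat K) ≅ delta 1 := Iso.refl _

open scoped Classical in
lemma deltaComul_counit_left (k : K) :
    eqToHom (congrArg delta (one_mul k).symm) ≫ deltaComul 1 k =
      (λ_ (delta k)).inv ≫ deltaUnit.hom ▷ delta k := by
  refine delta_hom_ext ?_
  rw [categoryOfGradedObjects_comp, reassoc_of% (deltaIso_inv_eqToHom (one_mul k).symm),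
    deltaIso_inv_deltaComul']
  have h : ((λ_ (delta k)).inv ≫ deltaUnit.hom ▷ delta k) (Additive.ofMul k) =
      (λ_ _).inv ≫ (deltaIso 1 _ rfl).inv ▷ _ ≫ tensorι (delta 1) (delta k) (Additive.ofMul 1)
        (Additive.ofMul k) (Additive.ofMul k) (zero_add (Additive.ofMul k)) := by
    -- The unit object of `Vec_K` is `δ_1` by definition, so `deltaUnit.hom` unfolds to an identity.
    have h₁ : deltaUnit.hom ▷ delta k = 𝟙 (delta (1 : K) ⊗ delta k) := id_whiskerRight _ _
    have h₂ : (λ_ (delta k)).inv ≫ deltaUnit.hom ▷ delta k = (λ_ (delta k)).inv :=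
      (congrArg ((λ_ (delta k)).inv ≫ ·) h₁).trans (Category.comp_id _)
    rw [h₂]
    exact Monoidal.leftUnitor_inv_apply (delta k) (Additive.ofMul k)
  rw [h, leftUnitor_inv_naturality_assoc, MonoidalCategory.tensorHom_def', Category.assoc]

open scoped Classical in
lemma deltaComul_counit_right (k : K) :
    eqToHom (congrArg delta (mul_one k).symm) ≫ deltaComul k 1 =
      (ρ_ (delta k)).inv ≫ delta k ◁ deltaUnit.hom := by
  refine delta_hom_ext ?_
  rw [categoryOfGradedObjects_comp, reassoc_of% (deltaIso_inv_eqToHom (mul_one k).symm),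
    deltaIso_inv_deltaComul']
  have h : ((ρ_ (delta k)).inv ≫ delta k ◁ deltaUnit.hom) (Additive.ofMul k) =
      (ρ_ _).inv ≫ _ ◁ (deltaIso 1 _ rfl).inv ≫ tensorι (delta k) (delta 1) (Additive.ofMul k)
        (Additive.ofMul 1) (Additive.ofMul k) (add_zero (Additive.ofMul k)) := by
    have h₁ : delta k ◁ deltaUnit.hom = 𝟙 (delta k ⊗ delta (1 : K)) :=
      MonoidalCategory.whiskerLeft_id _ _
    have h₂ : (ρ_ (delta k)).inv ≫ delta k ◁ deltaUnit.hom = (ρ_ (delta k)).inv :=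
      (congrArg ((ρ_ (delta k)).inv ≫ ·) h₁).trans (Category.comp_id _)
    rw [h₂]
    exact Monoidal.rightUnitor_inv_apply (delta k) (Additive.ofMul k)
  rw [h, rightUnitor_inv_naturality_assoc, MonoidalCategory.tensorHom_def, Category.assoc,
    unitors_inv_equal]

/-- The simple objects of `Vec_K`. -/
noncomputable def deltaBasis (K : Type u) [Group K] [Finite K] : PointedBasis K (VecCat K) where
  δ := delta
  mul := deltaMulIso
  one := deltaUnit
  assoc k l m := by
    have h : (whiskerRightIso (deltaMulIso k l) (delta m) ≪≫ deltaMulIso (k * l) m ≪≫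
        eqToIso (congrArg delta (mul_assoc k l m))).symm =
        (α_ _ _ _ ≪≫ whiskerLeftIso (delta k) (deltaMulIso l m) ≪≫
          deltaMulIso k (l * m)).symm := by
      ext1
      rw [← cancel_epi (eqToHom (congrArg delta (mul_assoc k l m))),
        ← cancel_mono (α_ (delta k) (delta l) (delta m)).hom]
      simpa [deltaMulIso] using deltaComul_coassoc k l m
    exact congrArg Iso.inv h
  one_leftUnit k := by
    have h : (whiskerRightIso deltaUnit (delta k) ≪≫ deltaMulIso 1 k ≪≫
        eqToIso (congrArg delta (one_mul k))).symm = (λ_ (delta k)).symm := by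
      ext1
      rw [← cancel_mono (deltaUnit.hom ▷ delta k)]
      simpa [deltaMulIso] using deltaComul_counit_left k
    exact congrArg Iso.inv h
  one_rightUnit k := by
    have h : (whiskerLeftIso (delta k) deltaUnit ≪≫ deltaMulIso k 1 ≪≫
        eqToIso (congrArg delta (mul_one k))).symm = (ρ_ (delta k)).symm := by
      ext1
      rw [← cancel_mono (delta k ◁ deltaUnit.hom)]
      simpa [deltaMulIso] using deltaComul_counit_right k
    exact congrArg Iso.inv h
  scalar := delta_scalar
  id_ne_zero := delta_id_ne_zero
  eq_zero := delta_hom_eq_zero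
  generates := delta_generates

end Multiplication

end VecCat

/-! ### The groupoid of cocycles -/

/-- The objects of the groupoid of pairs `(ω, η)` that are 2-cocycles of `D(Q, K, φ)`. -/
structure CocyclePair {K : Type u} {Q : Type v} [Group K] [Group Q] (φ : Q →* MulAut K) where
  ω : Q → K → K → ℂˣ
  η : K → Q → Q → ℂˣ
  isCocycleOver : IsCocycleOver φ ω η

namespace CocyclePair

variable {K : Type u} {Q : Type v} [Group K] [Group Q] {φ : Q →* MulAut K}

/-- Morphisms of cocycles are the 1-cochains that relate them. -/
@[ext]
structure Hom (x y : CocyclePair φ) where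
  c : Q → K → ℂˣ
  isRelatedBy : IsRelatedBy φ c x.ω x.η y.ω y.η

lemma _root_.VecActions.IsRelatedBy.mul {c d : Q → K → ℂˣ} {ω ω' ω'' : Q → K → K → ℂˣ}
    {η η' η'' : K → Q → Q → ℂˣ} (h : IsRelatedBy φ c ω η ω' η')
    (h' : IsRelatedBy φ d ω' η' ω'' η'') : IsRelatedBy φ (c * d) ω η ω'' η'' where
  left q k l := by
    simp only [Pi.mul_apply]
    rw [← mul_assoc, h.left, mul_assoc, h'.left]
    ac_rfl
  right q q' k := by
    simp only [Pi.mul_apply]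
    rw [← mul_assoc, h.right, mul_assoc, h'.right]
    ac_rfl

lemma _root_.VecActions.IsRelatedBy.inv {c : Q → K → ℂˣ} {ω ω' : Q → K → K → ℂˣ}
    {η η' : K → Q → Q → ℂˣ} (h : IsRelatedBy φ c ω η ω' η') :
    IsRelatedBy φ c⁻¹ ω' η' ω η where
  left q k l := by
    simp only [Pi.inv_apply]
    rw [mul_inv_eq_iff_eq_mul, mul_assoc, h.left, ← mul_inv, ← mul_assoc, inv_mul_cancel,
      one_mul]
  right q q' k := by
    simp only [Pi.inv_apply]
    rw [mul_inv_eq_iff_eq_mul, mul_assoc, h.right, ← mul_inv, ← mul_assoc, inv_mul_cancel,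
      one_mul]

instance : Groupoid (CocyclePair φ) where
  Hom := Hom
  id x := ⟨1, ⟨fun _ _ _ => by simp, fun _ _ _ => by simp⟩⟩
  comp f g := ⟨f.c * g.c, f.isRelatedBy.mul g.isRelatedBy⟩
  inv f := ⟨f.c⁻¹, f.isRelatedBy.inv⟩
  id_comp f := Hom.ext (one_mul f.c)
  comp_id f := Hom.ext (mul_one f.c)
  assoc f g h := Hom.ext (mul_assoc f.c g.c h.c)
  inv_comp f := Hom.ext (inv_mul_cancel f.c)
  comp_inv f := Hom.ext (mul_inv_cancel f.c)

@[ext]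
lemma hom_ext {x y : CocyclePair φ} {f g : x ⟶ y} (h : Hom.c f = Hom.c g) : f = g := Hom.ext h

lemma nonempty_iso_iff {x y : CocyclePair φ} :
    Nonempty (x ≅ y) ↔ ∃ c, IsRelatedBy φ c x.ω x.η y.ω y.η :=
  ⟨fun ⟨e⟩ => ⟨_, Hom.isRelatedBy e.hom⟩,
    fun ⟨c, hc⟩ => ⟨(Groupoid.isoEquivHom x y).symm ⟨c, hc⟩⟩⟩

/-- For the trivial homomorphism, the roles of the two groups can be exchanged. -/
def swap (K : Type u) (Q : Type v) [Group K] [Group Q] :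
    CocyclePair (1 : Q →* MulAut K) ⥤ CocyclePair (1 : K →* MulAut Q) where
  obj x :=
    { ω := x.η
      η := x.ω
      -- For trivial `φ` the mixed equation is its own mirror image, and `dk` and `dq` are exchanged
      -- up to sides and order of factors.
      isCocycleOver :=
        { dk := fun k q q' q'' => (x.isCocycleOver.dq k q q' q'').symm.trans (mul_comm _ _)
          mixed := fun k l q q' => (x.isCocycleOver.mixed q q' k l).symm
          dq := fun q k l m => (mul_comm _ _).trans (x.isCocycleOver.dk q k l m).symm } }
  map f :=
    { c := fun k q => Hom.c f q k
      isRelatedBy :=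
        { left := fun k q q' => (Hom.isRelatedBy f).right q q' k
          right := fun k l q => (Hom.isRelatedBy f).left q k l } }

/-- Exchanging the two groups is an equivalence. -/
def swapEquivalence (K : Type u) (Q : Type v) [Group K] [Group Q] :
    CocyclePair (1 : Q →* MulAut K) ≌ CocyclePair (1 : K →* MulAut Q) where
  functor := swap K Q
  inverse := swap Q K
  unitIso := Iso.refl _
  counitIso := Iso.refl _
  functor_unitIso_comp x := (Category.comp_id _).trans ((swap K Q).map_id x)

end CocyclePair

/-! ### The functor from a category of actions to cocycles -/

namespace PointedBasis

variable {K : Type u} [Group K] {C : Type v} [Category.{w} C] [MonoidalCategory C]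
  [Preadditive C] [Linear ℂ C] (B : PointedBasis K C)
  [MonoidalPreadditive C] [MonoidalLinear ℂ C] {Q : Type*} [Group Q] {φ : Q →* MulAut K}

/-- Rescaling the isomorphisms `θ` changes the scalars by a coboundary. -/
lemma Scalars.exists_rescale {B : PointedBasis K C} {T : TensorAction C Q}
    {θ : ∀ q k, (T.act q).functor.obj (B.δ k) ≅ B.δ (φ q k)} {ω ω' : Q → K → K → ℂˣ}
    {η η' : K → Q → Q → ℂˣ} {c : Q → K → ℂˣ} (h : B.Scalars φ T θ ω η)
    (hc : IsRelatedBy φ c ω η ω' η') : ∃ θ, B.Scalars φ T θ ω' η' := by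
  -- With `θ' = c • θ`, the identity has scalar `c` from `θ` to `θ'`. Composing with such identities
  -- leaves the structure maps alone and changes their scalars.
  let θ' q k : (T.act q).functor.obj (B.δ k) ≅ B.δ (φ q k) :=
    ⟨(c q k : ℂ) • (θ q k).hom, ((c q k)⁻¹ : ℂˣ) • (θ q k).inv,
      by simp [Units.smul_def, smul_smul], by simp [Units.smul_def, smul_smul]⟩
  have h₁ q k : B.IsScalar (θ q k) (θ' q k) (c q k) (𝟙 _) := ⟨rfl, by simp [θ']⟩
  have h₂ q k : B.IsScalar (θ' q k) (θ q k) ((c q k)⁻¹ : ℂˣ) (𝟙 _) :=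
    ⟨rfl, by simp [θ', smul_smul]⟩
  have h₃ q {X : C} {k : K} (x : X ≅ B.δ k) :
      B.IsScalar (B.map (φ := φ q) (θ q) x) (B.map (φ := φ q) (θ' q) x) (c q k) (𝟙 _) :=
    IsScalar.app (F := (T.act q).functor) (α := 𝟙 _) (h₁ q k) x
  have h₄ q {X : C} {k : K} (x : X ≅ B.δ k) :
      B.IsScalar (B.map (φ := φ q) (θ' q) x) (B.map (φ := φ q) (θ q) x) ((c q k)⁻¹ : ℂˣ) (𝟙 _) :=
    IsScalar.app (F := (T.act q).functor) (α := 𝟙 _) (h₂ q k) x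
  refine ⟨θ', fun q k l => ?_, fun q q' k => ?_⟩
  · have h₅ := (((h₂ q k).tensorHom (h₂ q l)).comp (h.tensor q k l)).comp (h₃ q (B.mul k l))
    rw [Category.comp_id, id_tensorHom_id, Category.id_comp] at h₅
    have h₆ := hc.left q k l
    have h₇ : ω' q k l = (c q k)⁻¹ * (c q l)⁻¹ * ω q k l * c q (k * l) := by
      rw [mul_assoc, h₆, ← mul_inv, ← mul_assoc, inv_mul_cancel, one_mul]
    rw [h₇]
    exact_mod_cast h₅
  · have h₅ := (((h₄ q (θ' q' k)).comp ((h₂ q' k).map (F := (T.act q).functor) (φ := φ q)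
      (θ q))).comp (h.mul q q' k)).comp (h₁ (q * q') k)
    rw [Category.comp_id, CategoryTheory.Functor.map_id, Category.id_comp, Category.id_comp] at h₅
    have h₆ := hc.right q q' k
    have h₇ : η' k q q' = (c q (φ q' k))⁻¹ * (c q' k)⁻¹ * η k q q' * c (q * q') k := by
      rw [mul_assoc, h₆, ← mul_inv, ← mul_assoc, inv_mul_cancel, one_mul]
    rw [h₇]
    exact_mod_cast h₅

section CocycleFunctor

variable {𝒜 : Type*} [Category* 𝒜] (U : 𝒜 ⥤ TensorAction C Q)
  (hU : ∀ (T : 𝒜) (q : Q) (k : K),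
    Nonempty (((U.obj T).act q).functor.obj (B.δ k) ≅ B.δ (φ q k)))

/-- A choice of isomorphisms with simple objects. -/
noncomputable def chosenIso (T : 𝒜) (q : Q) (k : K) :
    ((U.obj T).act q).functor.obj (B.δ k) ≅ B.δ (φ q k) :=
  (hU T q k).some

/-- The scalars of an action with respect to the chosen isomorphisms. -/
noncomputable def chosenPair (T : 𝒜) : CocyclePair φ where
  ω := (B.exists_scalars (U.obj T) (B.chosenIso U hU T)).choose
  η := (B.exists_scalars (U.obj T) (B.chosenIso U hU T)).choose_spec.choose
  isCocycleOver :=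
    (B.exists_scalars (U.obj T) (B.chosenIso U hU T)).choose_spec.choose_spec.isCocycleOver

lemma scalars_chosenPair (T : 𝒜) : B.Scalars φ (U.obj T) (B.chosenIso U hU T)
    (B.chosenPair U hU T).ω (B.chosenPair U hU T).η :=
  (B.exists_scalars (U.obj T) (B.chosenIso U hU T)).choose_spec.choose_spec

/-- The scalars of a morphism of actions. -/
noncomputable def chosenHom {T T' : 𝒜} (f : T ⟶ T') :
    B.chosenPair U hU T ⟶ B.chosenPair U hU T' where
  c := ((B.scalars_chosenPair U hU T).exists_isRelatedBy (B.scalars_chosenPair U hU T')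
    (U.map f)).choose
  isRelatedBy := ((B.scalars_chosenPair U hU T).exists_isRelatedBy (B.scalars_chosenPair U hU T')
    (U.map f)).choose_spec.2

lemma isScalar_chosenHom {T T' : 𝒜} (f : T ⟶ T') (q : Q) (k : K) :
    B.IsScalar (B.chosenIso U hU T q k) (B.chosenIso U hU T' q k)
      ((B.chosenHom U hU f).c q k : ℂˣ) (((U.map f).hom.app ⟨q⟩).iso.hom.app (B.δ k)) :=
  ((B.scalars_chosenPair U hU T).exists_isRelatedBy (B.scalars_chosenPair U hU T')
    (U.map f)).choose_spec.1 q k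

/-- The functor that sends an action to its scalars. -/
noncomputable def cocycleFunctor : 𝒜 ⥤ CocyclePair φ where
  obj := B.chosenPair U hU
  map := B.chosenHom U hU
  map_id T := by
    ext q k : 4
    refine (B.isScalar_chosenHom U hU (𝟙 T) q k).unique ?_
    rw [U.map_id]
    exact IsScalar.id _
  map_comp f g := by
    ext q k : 4
    refine (B.isScalar_chosenHom U hU (f ≫ g) q k).unique ?_
    rw [U.map_comp]
    exact_mod_cast (B.isScalar_chosenHom U hU f q k).comp (B.isScalar_chosenHom U hU g q k)

instance [U.Faithful] : (B.cocycleFunctor U hU).Faithful where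
  map_injective {T T'} f g h := by
    refine U.map_injective (Scalars.hom_ext (B.isScalar_chosenHom U hU f) fun q k => ?_)
    have h' : B.chosenHom U hU f = B.chosenHom U hU g := h
    rw [h']
    exact B.isScalar_chosenHom U hU g q k

instance [U.Full] : (B.cocycleFunctor U hU).Full where
  map_surjective {T T'} c := by
    obtain ⟨f, hf⟩ := (B.scalars_chosenPair U hU T).exists_hom (B.scalars_chosenPair U hU T')
      c.isRelatedBy
    obtain ⟨f, rfl⟩ := U.map_surjective f
    refine ⟨f, ?_⟩
    ext q k : 4
    exact (B.isScalar_chosenHom U hU f q k).unique (hf q k)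

/-- Two pairs of the same action are related by the scalars of its identity morphism; conversely, a
pair related to the chosen one arises by rescaling the chosen isomorphisms. -/
lemma exists_scalars_iff (T : 𝒜) (ω : Q → K → K → ℂˣ) (η : K → Q → Q → ℂˣ) :
    (∃ θ, B.Scalars φ (U.obj T) θ ω η) ↔
      ∃ h, Nonempty ((B.cocycleFunctor U hU).obj T ≅ ⟨ω, η, h⟩) := by
  simp only [CocyclePair.nonempty_iso_iff]
  constructor
  · rintro ⟨θ, h⟩
    obtain ⟨c, -, hc⟩ := (B.scalars_chosenPair U hU T).exists_isRelatedBy h (𝟙 _)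
    exact ⟨h.isCocycleOver, c, hc⟩
  · rintro ⟨h, c, hc⟩
    exact (B.scalars_chosenPair U hU T).exists_rescale hc

end CocycleFunctor

end PointedBasis

/-! ### Actions that fix isomorphism classes -/

section Fixing

variable {C : Type u} [Category.{v} C] [MonoidalCategory C] [Preadditive C] [Linear ℂ C]
  {Q : Type w} [Group Q]

variable (C Q) in
/-- Forget that the autoequivalences preserve isomorphism classes, as a functor. -/
def forgetFixing : TensorAction₀ C Q ⥤ TensorAction C Q where
  obj T := T.toTensorAction
  map f := LaxMonoidalFunctor.Hom.mk (Functor.whiskerRight f.hom (fixesIsoClasses C).ι)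
    (inferInstanceAs (NatTrans.IsMonoidal (Functor.whiskerRight f.hom (fixesIsoClasses C).ι)))

instance : (forgetFixing C Q).Faithful where
  map_injective {T T'} f g h := by
    ext q : 3
    exact ObjectProperty.hom_ext _
      (congrArg (fun α : T.toTensorAction ⟶ T'.toTensorAction => α.hom.app q) h)

instance : (forgetFixing C Q).Full where
  map_surjective {T T'} f := by
    let α : T.toFunctor ⟶ T'.toFunctor :=
      { app := fun q => ObjectProperty.homMk (f.hom.app q)
        naturality := fun q q' g => ObjectProperty.hom_ext _ (f.hom.naturality g) }
    have hα : NatTrans.IsMonoidal α :=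
      { unit := by
          refine ObjectProperty.hom_ext _ ?_
          have h := f.isMonoidal.unit
          -- The structure maps of a composite with the inclusion `ι` carry an identity as first
          -- factor.
          exact (congrArg (· ≫ _) (Category.id_comp _).symm).trans (h.trans (Category.id_comp _))
        tensor := fun q q' => by
          refine ObjectProperty.hom_ext _ ?_
          have h := f.isMonoidal.tensor q q'
          exact (congrArg (· ≫ _) (Category.id_comp _).symm).trans
            (h.trans (congrArg (_ ≫ ·) (Category.id_comp _))) }
    exact ⟨⟨α, hα⟩, rfl⟩

/-- Lift an action to one by autoequivalences that preserve isomorphism classes. -/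
def TensorAction.fixing (T : TensorAction C Q) (h : ∀ q, fixesIsoClasses C (T.act q)) :
    TensorAction₀ C Q where
  toFunctor := (fixesIsoClasses C).lift T.toFunctor fun q => h q.as
  laxMonoidal :=
    { ε := ObjectProperty.homMk (ε T.toFunctor)
      μ := fun q q' => ObjectProperty.homMk (μ T.toFunctor q q')
      μ_natural_left := fun f q => ObjectProperty.hom_ext _ (μ_natural_left T.toFunctor f q)
      μ_natural_right := fun q f => ObjectProperty.hom_ext _ (μ_natural_right T.toFunctor q f)
      associativity := fun q q' q'' =>
        ObjectProperty.hom_ext _ (associativity T.toFunctor q q' q'')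
      left_unitality := fun q => ObjectProperty.hom_ext _ (left_unitality T.toFunctor q)
      right_unitality := fun q => ObjectProperty.hom_ext _ (right_unitality T.toFunctor q) }

lemma PointedBasis.Scalars.fixing {K : Type*} [Group K] {B : PointedBasis K C}
    {φ : Q →* MulAut K} {T : TensorAction C Q}
    {θ : ∀ q k, (T.act q).functor.obj (B.δ k) ≅ B.δ (φ q k)} {ω : Q → K → K → ℂˣ}
    {η : K → Q → Q → ℂˣ} (hT : B.Scalars φ T θ ω η) (h : ∀ q, fixesIsoClasses C (T.act q)) :
    B.Scalars φ (T.fixing h).toTensorAction θ ω η where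
  tensor := hT.tensor
  mul q q' k := (hT.mul q q' k).congr (Category.id_comp _).symm

end Fixing

/-! ### Actions on `Vec_K` -/

section ActionsOnVec

variable {K : Type u} {Q : Type v} [Group K] [Finite K] [Group Q]

lemma hasScalars_iff {φ : Q →* MulAut K} {T : TensorAction (VecCat K) Q}
    {θ : ∀ q k, (T.act q).functor.obj (delta k) ≅ delta (φ q k)}
    {ω : Q → K → K → ℂˣ} {η : K → Q → Q → ℂˣ} :
    HasScalars φ T θ ω η ↔ (deltaBasis K).Scalars φ T θ ω η := by
  constructor
  · refine fun h => ⟨fun q k l => ⟨(map_mul (φ q) k l).symm, ?_⟩, fun q q' k =>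
      ⟨by rw [map_mul, MulAut.mul_apply], ?_⟩⟩
    · refine (h.tensor q k l).trans (congrArg _ ?_)
      exact (Category.assoc _ _ _).symm
    · refine (h.mul q q' k).trans (congrArg _ ?_)
      exact (Category.assoc _ _ _).symm
  · refine fun h => ⟨fun q k l => ?_, fun q q' k => ?_⟩
    · refine (h.tensor q k l).2.trans (congrArg _ ?_)
      exact Category.assoc _ _ _
    · refine (h.mul q q' k).2.trans (congrArg _ ?_)
      exact Category.assoc _ _ _

/-- The action of an automorphism of `K` on the set of degrees. -/
def degreeEquiv (f : MulAut K) : Additive K ≃ Additive K :=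
  Additive.toMul.trans (f.toEquiv.trans Additive.ofMul)

/-- The autoequivalence of `Vec_K` that permutes the degrees by an automorphism of `K`. -/
abbrev regrade (f : MulAut K) : VecCat K ⥤ VecCat K :=
  (GradedObject.comapEquiv (FGModuleCat.{0} ℂ) (degreeEquiv f)).functor

instance (f : MulAut K) : (regrade f).Additive where
  map_add := rfl

instance (f : MulAut K) : (regrade f).Linear ℂ where
  map_smul _ _ := rfl

open scoped Classical in
/-- Regrading permutes the simple objects. -/
noncomputable def regradeDelta (f : MulAut K) (k : K) : (regrade f).obj (delta k) ≅ delta (f k) :=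
  -- In degree `n` both objects are case distinctions with the same branches and equivalent
  -- conditions, so the families are equal.
  eqToIso <| funext fun n => by
    have h : (degreeEquiv f).symm n = Additive.ofMul k ↔ n = Additive.ofMul (f k) :=
      (degreeEquiv f).symm_apply_eq
    exact if_congr h rfl rfl

variable (φ : Q →* MulAut K)

/-- Every cocycle is realized by an action on `Vec_K`. -/
lemma exists_hasScalars {φ : Q →* MulAut K} {ω : Q → K → K → ℂˣ} {η : K → Q → Q → ℂˣ}
    (h : IsCocycleOver φ ω η) : ∃ (T : TensorAction (VecCat K) Q) (θ : _),
      (deltaBasis K).Scalars φ T θ ω η :=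
  (deltaBasis K).exists_action (fun q => regrade (φ q)) (fun q k => regradeDelta (φ q) k) h

lemma nonempty_iso_of_projectsTo (T : ActionOver φ) (q : Q) (k : K) :
    Nonempty ((((projectsTo φ).ι.obj T).act q).functor.obj ((deltaBasis K).δ k) ≅
      (deltaBasis K).δ (φ q k)) :=
  T.property q k

/-- The groupoid of actions over `φ` is that of cocycles. -/
noncomputable def actionOverToCocycle : ActionOver φ ⥤ CocyclePair φ :=
  (deltaBasis K).cocycleFunctor (projectsTo φ).ι (nonempty_iso_of_projectsTo φ)

instance : (actionOverToCocycle φ).Faithful :=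
  inferInstanceAs ((deltaBasis K).cocycleFunctor (projectsTo φ).ι
    (nonempty_iso_of_projectsTo φ)).Faithful

instance : (actionOverToCocycle φ).Full :=
  inferInstanceAs ((deltaBasis K).cocycleFunctor (projectsTo φ).ι
    (nonempty_iso_of_projectsTo φ)).Full

variable {φ} in
lemma isGivenBy_iff (T : ActionOver φ) (ω : Q → K → K → ℂˣ) (η : K → Q → Q → ℂˣ) :
    IsGivenBy φ T.obj ω η ↔
      ∃ h, Nonempty ((actionOverToCocycle φ).obj T ≅ ⟨ω, η, h⟩) :=
  (exists_congr fun _ => hasScalars_iff).trans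
    ((deltaBasis K).exists_scalars_iff (projectsTo φ).ι (nonempty_iso_of_projectsTo φ) T ω η)

instance : (actionOverToCocycle φ).EssSurj where
  mem_essImage x := by
    obtain ⟨T, θ, h⟩ := exists_hasScalars x.isCocycleOver
    let T' : ActionOver φ := ⟨T, fun q k => ⟨θ q k⟩⟩
    obtain ⟨_, e⟩ := (isGivenBy_iff T' x.ω x.η).1 ⟨θ, hasScalars_iff.2 h⟩
    exact ⟨T', e⟩

variable (K Q)

lemma nonempty_iso_of_fixing (T : TensorAction₀ (VecCat K) Q) (q : Q) (k : K) :
    Nonempty ((((forgetFixing (VecCat K) Q).obj T).act q).functor.obj ((deltaBasis K).δ k) ≅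
      (deltaBasis K).δ ((1 : Q →* MulAut K) q k)) :=
  (T.obj (Discrete.mk q)).property (delta k)

/-- The groupoid of actions that fix isomorphism classes is that of cocycles. -/
noncomputable def fixingToCocycle :
    TensorAction₀ (VecCat K) Q ⥤ CocyclePair (1 : Q →* MulAut K) :=
  (deltaBasis K).cocycleFunctor (forgetFixing (VecCat K) Q) (nonempty_iso_of_fixing K Q)

instance : (fixingToCocycle K Q).Faithful :=
  inferInstanceAs ((deltaBasis K).cocycleFunctor (forgetFixing (VecCat K) Q)
    (nonempty_iso_of_fixing K Q)).Faithful

instance : (fixingToCocycle K Q).Full :=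
  inferInstanceAs ((deltaBasis K).cocycleFunctor (forgetFixing (VecCat K) Q)
    (nonempty_iso_of_fixing K Q)).Full

variable {K Q} in
lemma isGivenBy₀_iff (T : TensorAction₀ (VecCat K) Q) (ω : Q → K → K → ℂˣ)
    (η : K → Q → Q → ℂˣ) :
    IsGivenBy₀ T ω η ↔ ∃ h, Nonempty ((fixingToCocycle K Q).obj T ≅ ⟨ω, η, h⟩) :=
  (exists_congr fun _ => hasScalars_iff).trans
    ((deltaBasis K).exists_scalars_iff (forgetFixing (VecCat K) Q)
      (nonempty_iso_of_fixing K Q) T ω η)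

instance : (fixingToCocycle K Q).EssSurj where
  mem_essImage x := by
    obtain ⟨T, θ, h⟩ := exists_hasScalars x.isCocycleOver
    have hT q : fixesIsoClasses (VecCat K) (T.act q) :=
      (deltaBasis K).fixesIsoClasses_of_simple _ (θ q)
    obtain ⟨_, e⟩ := (isGivenBy₀_iff (T.fixing hT) x.ω x.η).1
      ⟨θ, hasScalars_iff.2 (h.fixing hT)⟩
    exact ⟨_, e⟩

instance : (fixingToCocycle K Q).IsEquivalence where

end ActionsOnVec

/-! ### Cocycles of double groups -/

section Cocycles

variable {K : Type u} {Q : Type v} [Group K] [Group Q] {φ : Q →* MulAut K}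

lemma isCocyclePair_iff {ω : Q → K → K → ℂˣ} {η : K → Q → Q → ℂˣ} :
    IsCocyclePair ω η ↔ IsCocycleOver 1 ω η := by
  have h₁ (a b c x y z : ℂˣ) : a * b⁻¹ * c = x * y⁻¹ * z ↔ c * a * y = z * x * b := by
    rw [mul_right_comm, mul_right_comm x, ← div_eq_mul_inv, ← div_eq_mul_inv,
      div_eq_div_iff_mul_eq_mul, mul_comm a, mul_comm x]
  have h₂ (a b c d : ℂˣ) : a * b⁻¹ * c * d⁻¹ = 1 ↔ a * c = b * d := by
    rw [mul_inv_eq_one, mul_right_comm, mul_inv_eq_iff_eq_mul, mul_comm d]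
  constructor
  · refine fun h => ⟨fun q k l m => (h₂ _ _ _ _).1 (h.dk q k l m), fun q q' k l =>
      (h₁ _ _ _ _ _ _).1 (h.mixed q q' k l), fun k q q' q'' => ?_⟩
    exact (mul_comm _ _).trans ((h₂ _ _ _ _).1 (h.dq k q q' q'')).symm
  · refine fun h => ⟨fun q q' k l => (h₁ _ _ _ _ _ _).2 (h.mixed q q' k l), fun q k l m =>
      (h₂ _ _ _ _).2 (h.dk q k l m), fun k q q' q'' => (h₂ _ _ _ _).2 ?_⟩
    exact (h.dq k q q' q'').symm.trans (mul_comm _ _)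

/-- The cochain goes from `(ω', η')` to `(ω, η)`, so that solving for the primed pair gives `d₁` of
`c` and not of its inverse. -/
lemma exists_isRelatedBy_one_iff {ω ω' : Q → K → K → ℂˣ} {η η' : K → Q → Q → ℂˣ} :
    (∃ c, IsRelatedBy 1 c ω' η' ω η) ↔ ∃ c : Q → K → ℂˣ,
      (∀ q k k', ω' q k k' = d₁ (c q) k k' * ω q k k') ∧
        (∀ k q q', η' k q q' = d₁ (fun x => c x k) q q' * η k q q') := by
  have h₁ (a b x y z : ℂˣ) : a * y = z * x * b ↔ a = x * y⁻¹ * z * b := by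
    rw [← eq_mul_inv_iff_mul_eq]
    refine Eq.congr_right ?_
    ac_rfl
  refine exists_congr fun c => ⟨fun h => ⟨fun q k k' => (h₁ _ _ _ _ _).1 (h.left q k k'),
    fun k q q' => (h₁ _ _ _ _ _).1 (h.right q q' k)⟩, fun h => ⟨fun q k k' =>
      (h₁ _ _ _ _ _).2 (h.1 q k k'), fun q q' k => (h₁ _ _ _ _ _).2 (h.2 k q q')⟩⟩

namespace DoubleGroup

/-- In a row of squares all vertical edges agree, and in a column the lowest edge determines the
horizontal edges above it. So horizontal triples, grids and vertical triples are parametrized by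
`(q, k, l, m)`, `(q, q', k, l)` and `(k, q, q', q'')`, the variables of the three equations. -/
lemma cochainOfPair_mem_Z2_iff {ω : Q → K → K → ℂˣ} {η : K → Q → Q → ℂˣ} :
    cochainOfPair ℂˣ φ ω η ∈ Z2 (ofAction φ) ℂˣ ↔ IsCocycleOver φ ω η := by
  have h₁ (a b c x y z : ℂˣ) : a / b * c / (x / y * z) = 1 ↔ c * a * y = z * x * b := by
    rw [div_eq_one, div_mul_eq_mul_div, div_mul_eq_mul_div, div_eq_div_iff_mul_eq_mul,
      mul_comm a, mul_comm x]
  have h₂ (a b c d : ℂˣ) : a / b * c / d = 1 ↔ a * c = b * d := by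
    rw [div_eq_one, div_mul_eq_mul_div, div_eq_iff_eq_mul, mul_comm d]
  rw [MonoidHom.mem_ker]
  constructor
  · intro h
    have hH := congrArg Prod.fst h
    have hG := congrArg (fun x => x.2.1) h
    have hV := congrArg (fun x => x.2.2) h
    refine ⟨fun q k l m => ?_, fun q q' k l => ?_, fun k q q' q'' => ?_⟩
    · exact (h₂ _ _ _ _).1 (congrFun hH ⟨((q, k), (q, l), (q, m)), rfl, rfl⟩)
    · exact ((h₁ _ _ _ _ _ _).1 (congrFun hG
        ⟨(((q, φ q' k), (q, φ q' l)), ((q', k), (q', l))), ⟨rfl, rfl⟩, rfl, rfl⟩))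
    · have := (h₂ _ _ _ _).1 (congrFun hV
        ⟨((q, φ q' (φ q'' k)), (q', φ q'' k), (q'', k)), rfl, rfl⟩)
      exact (mul_comm _ _).trans this.symm
  · intro h
    refine Prod.ext ?_ (Prod.ext ?_ ?_)
    · funext ⟨⟨⟨q, k⟩, ⟨q', l⟩, ⟨q'', m⟩⟩, h', h''⟩
      obtain rfl : q = q' := h'
      obtain rfl : q = q'' := h''
      exact (h₂ _ _ _ _).2 (h.dk q k l m)
    · funext ⟨⟨⟨⟨q, k'⟩, ⟨q₁, l'⟩⟩, ⟨q', k⟩, ⟨q₁', l⟩⟩, ⟨h₃, h₄⟩, h₅, h₆⟩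
      obtain rfl : q = q₁ := h₃
      obtain rfl : q' = q₁' := h₄
      obtain rfl : k' = φ q' k := h₅
      obtain rfl : l' = φ q' l := h₆
      exact (h₁ _ _ _ _ _ _).2 (h.mixed q q' k l)
    · funext ⟨⟨⟨q, k''⟩, ⟨q', k'⟩, ⟨q'', k⟩⟩, h', h''⟩
      obtain rfl : k' = φ q'' k := h''
      exact (h₂ _ _ _ _).2 ((h.dq k q q' q'').symm.trans (mul_comm _ _))

/-- The 2-cocycle of `D(Q, K, φ)` of a pair. -/
def cocycleOfPair (x : CocyclePair φ) : Z2 (ofAction φ) ℂˣ :=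
  ⟨cochainOfPair ℂˣ φ x.ω x.η, cochainOfPair_mem_Z2_iff.2 x.isCocycleOver⟩

lemma cocycleOfPair_surjective : Function.Surjective (cocycleOfPair (φ := φ)) := by
  rintro ⟨⟨f, g⟩, h⟩
  let ω q k l := f ⟨((q, k), (q, l)), rfl⟩
  let η k q q' := g ⟨((q, φ q' k), (q', k)), rfl⟩
  have h' : cochainOfPair ℂˣ φ ω η = (f, g) := by
    refine Prod.ext ?_ ?_
    · funext ⟨⟨⟨q, k⟩, ⟨q', l⟩⟩, h'⟩
      obtain rfl : q = q' := h'
      rfl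
    · funext ⟨⟨⟨q, k'⟩, ⟨q', k⟩⟩, h'⟩
      obtain rfl : k' = φ q' k := h'
      rfl
  exact ⟨⟨ω, η, cochainOfPair_mem_Z2_iff.1 (h'.symm ▸ h)⟩, Subtype.ext h'⟩

lemma mk_cocycleOfPair_eq_iff {x y : CocyclePair φ} :
    (QuotientGroup.mk (cocycleOfPair x) : H2 (ofAction φ) ℂˣ) =
      QuotientGroup.mk (cocycleOfPair y) ↔ Nonempty (x ≅ y) := by
  have h₁ (a b u v w : ℂˣ) : u / v * w = a⁻¹ * b ↔ b * v = w * u * a := by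
    rw [div_mul_eq_mul_div, div_eq_iff_eq_mul, mul_assoc, eq_inv_mul_iff_mul_eq, eq_comm,
      mul_comm u, mul_comm a]
  -- `QuotientGroup.eq` makes `x⁻¹ * y` the coboundary of `c`, and such a `c` relates `y` to `x`;
  -- hence the reversal.
  rw [QuotientGroup.eq, Subgroup.mem_subgroupOf, show Nonempty (x ≅ y) ↔ Nonempty (y ≅ x) from
    ⟨fun ⟨e⟩ => ⟨e.symm⟩, fun ⟨e⟩ => ⟨e.symm⟩⟩, CocyclePair.nonempty_iso_iff]
  constructor
  · rintro ⟨c, hc⟩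
    refine ⟨fun q k => c (q, k), fun q k l => ?_, fun q q' k => ?_⟩
    · exact (h₁ _ _ _ _ _).1 (congrFun (congrArg Prod.fst hc) ⟨((q, k), (q, l)), rfl⟩)
    · exact (h₁ _ _ _ _ _).1
        (congrFun (congrArg Prod.snd hc) ⟨((q, φ q' k), (q', k)), rfl⟩)
  · rintro ⟨c, hc⟩
    refine ⟨fun s => c s.1 s.2, Prod.ext ?_ ?_⟩
    · funext ⟨⟨⟨q, k⟩, ⟨q', l⟩⟩, h'⟩
      obtain rfl : q = q' := h'
      exact (h₁ _ _ _ _ _).2 (hc.left q k l)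
    · funext ⟨⟨⟨q, k'⟩, ⟨q', k⟩⟩, h'⟩
      obtain rfl : k' = φ q' k := h'
      exact (h₁ _ _ _ _ _).2 (hc.right q q' k)

end DoubleGroup

end Cocycles

/-! ### The classification and the symmetry -/

section Classification

open DoubleGroup

variable {K : Type u} {Q : Type v} [Group K] [Finite K] [Group Q]

/-- The cohomology class of an action. -/
noncomputable def cohomologyClass (φ : Q →* MulAut K) :
    Quotient (isIsomorphicSetoid (ActionOver φ)) → H2 (ofAction φ) ℂˣ :=
  Quotient.lift (fun T => QuotientGroup.mk (cocycleOfPair ((actionOverToCocycle φ).obj T)))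
    fun _ _ ⟨e⟩ => mk_cocycleOfPair_eq_iff.2 ⟨(actionOverToCocycle φ).mapIso e⟩

/-- Injectivity lifts an isomorphism of cocycles along the fully faithful functor
`actionOverToCocycle`; surjectivity is its essential surjectivity. -/
lemma cohomologyClass_bijective (φ : Q →* MulAut K) :
    Function.Bijective (cohomologyClass φ) := by
  constructor
  · rintro ⟨T⟩ ⟨T'⟩ h
    obtain ⟨e⟩ := mk_cocycleOfPair_eq_iff.1 h
    exact Quotient.sound ⟨(actionOverToCocycle φ).preimageIso e⟩
  · intro z
    obtain ⟨z, rfl⟩ := QuotientGroup.mk_surjective z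
    obtain ⟨x, rfl⟩ := cocycleOfPair_surjective z
    exact ⟨Quotient.mk _ ((actionOverToCocycle φ).objPreimage x),
      mk_cocycleOfPair_eq_iff.2 ⟨(actionOverToCocycle φ).objObjPreimageIso x⟩⟩

lemma isGivenBy_iff_cohomologyClass {φ : Q →* MulAut K} (T : ActionOver φ)
    (ω : Q → K → K → ℂˣ) (η : K → Q → Q → ℂˣ) :
    IsGivenBy φ T.obj ω η ↔ ∃ h : cochainOfPair ℂˣ φ ω η ∈ Z2 (ofAction φ) ℂˣ,
      cohomologyClass φ (Quotient.mk _ T) = QuotientGroup.mk ⟨_, h⟩ := by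
  rw [isGivenBy_iff]
  constructor
  · rintro ⟨h, e⟩
    exact ⟨cochainOfPair_mem_Z2_iff.2 h, mk_cocycleOfPair_eq_iff.2 e⟩
  · rintro ⟨h, e⟩
    exact ⟨cochainOfPair_mem_Z2_iff.1 h,
      (mk_cocycleOfPair_eq_iff (y := ⟨ω, η, cochainOfPair_mem_Z2_iff.1 h⟩)).1 e⟩

lemma exists_isGivenBy₀ (T : TensorAction₀ (VecCat K) Q) : ∃ ω η, IsGivenBy₀ T ω η :=
  ⟨_, _, (isGivenBy₀_iff T _ _).2 ⟨((fixingToCocycle K Q).obj T).isCocycleOver, ⟨Iso.refl _⟩⟩⟩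

lemma exists_isGivenBy₀_iff (ω : Q → K → K → ℂˣ) (η : K → Q → Q → ℂˣ) :
    (∃ T : TensorAction₀ (VecCat K) Q, IsGivenBy₀ T ω η) ↔ IsCocyclePair ω η := by
  simp only [isGivenBy₀_iff, isCocyclePair_iff]
  exact ⟨fun ⟨_, h, _⟩ => h, fun h => ⟨(fixingToCocycle K Q).objPreimage ⟨ω, η, h⟩, h,
    ⟨(fixingToCocycle K Q).objObjPreimageIso _⟩⟩⟩

lemma nonempty_iso_iff_of_isGivenBy₀ {T T' : TensorAction₀ (VecCat K) Q}
    {ω ω' : Q → K → K → ℂˣ} {η η' : K → Q → Q → ℂˣ} (hT : IsGivenBy₀ T ω η)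
    (hT' : IsGivenBy₀ T' ω' η') :
    Nonempty (T ≅ T') ↔ ∃ c : Q → K → ℂˣ,
      (∀ q k k', ω' q k k' = d₁ (c q) k k' * ω q k k') ∧
        (∀ k q q', η' k q q' = d₁ (fun x => c x k) q q' * η k q q') := by
  obtain ⟨h, ⟨e⟩⟩ := (isGivenBy₀_iff T ω η).1 hT
  obtain ⟨h', ⟨e'⟩⟩ := (isGivenBy₀_iff T' ω' η').1 hT'
  rw [← exists_isRelatedBy_one_iff]
  refine Iff.trans ?_ (CocyclePair.nonempty_iso_iff (x := ⟨ω', η', h'⟩) (y := ⟨ω, η, h⟩))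
  exact ⟨fun ⟨f⟩ => ⟨e'.symm ≪≫ (fixingToCocycle K Q).mapIso f.symm ≪≫ e⟩,
    fun ⟨f⟩ => ⟨(fixingToCocycle K Q).preimageIso (e ≪≫ f.symm ≪≫ e'.symm)⟩⟩

variable (K Q) in
/-- Exchanging the roles of `Q` and `K`. -/
noncomputable def actionSwap [Finite Q] :
    TensorAction₀ (VecCat K) Q ≌ TensorAction₀ (VecCat Q) K :=
  (fixingToCocycle K Q).asEquivalence.trans
    ((CocyclePair.swapEquivalence K Q).trans (fixingToCocycle Q K).asEquivalence.symm)

lemma isGivenBy₀_actionSwap_iff [Finite Q] (T : TensorAction₀ (VecCat K) Q)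
    (ω : Q → K → K → ℂˣ) (η : K → Q → Q → ℂˣ) :
    IsGivenBy₀ T ω η ↔ IsGivenBy₀ ((actionSwap K Q).functor.obj T) η ω := by
  rw [isGivenBy₀_iff, isGivenBy₀_iff]
  -- `actionSwap` ends with an inverse of `fixingToCocycle Q K`, so taking the cocycle again returns
  -- the swapped pair up to the counit.
  let e : (fixingToCocycle Q K).obj ((actionSwap K Q).functor.obj T) ≅
      (CocyclePair.swap K Q).obj ((fixingToCocycle K Q).obj T) :=
    (fixingToCocycle Q K).asEquivalence.counitIso.app _
  constructor
  · rintro ⟨h, ⟨f⟩⟩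
    exact ⟨((CocyclePair.swap K Q).obj ⟨ω, η, h⟩).isCocycleOver,
      ⟨e ≪≫ (CocyclePair.swap K Q).mapIso f⟩⟩
  · rintro ⟨h, ⟨f⟩⟩
    exact ⟨((CocyclePair.swap Q K).obj ⟨η, ω, h⟩).isCocycleOver,
      ⟨(CocyclePair.swap Q K).mapIso (e.symm ≪≫ f)⟩⟩

end Classification

end VecActions

theorem mainTheorem8 (K : Type u) (Q : Type v) [Group K] [Finite K] [Group Q] [Finite Q] :
    -- actions over a fixed `φ` are classified by the second cohomology of the double group
    (∀ φ : Q →* MulAut K,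
      ∃ e : Quotient (isIsomorphicSetoid (VecActions.ActionOver φ)) ≃
          VecActions.DoubleGroup.H2 (VecActions.DoubleGroup.ofAction φ) ℂˣ,
        ∀ (T : VecActions.ActionOver φ) (ω : Q → K → K → ℂˣ) (η : K → Q → Q → ℂˣ),
          VecActions.IsGivenBy φ T.obj ω η ↔
            ∃ h : VecActions.DoubleGroup.cochainOfPair ℂˣ φ ω η ∈
                VecActions.DoubleGroup.Z2 (VecActions.DoubleGroup.ofAction φ) ℂˣ,
              e (Quotient.mk _ T) = QuotientGroup.mk ⟨_, h⟩) ∧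
    -- actions that fix isomorphism classes amount to pairs `(ω, η)` subject to the conditions
    (∀ T : VecActions.TensorAction₀ (VecActions.VecCat K) Q,
      ∃ ω η, VecActions.IsGivenBy₀ T ω η) ∧
    (∀ ω η, (∃ T : VecActions.TensorAction₀ (VecActions.VecCat K) Q,
      VecActions.IsGivenBy₀ T ω η) ↔ VecActions.IsCocyclePair ω η) ∧
    (∀ (T T' : VecActions.TensorAction₀ (VecActions.VecCat K) Q) (ω ω' η η'),
      VecActions.IsGivenBy₀ T ω η → VecActions.IsGivenBy₀ T' ω' η' →
        (Nonempty (T ≅ T') ↔ ∃ c : Q → K → ℂˣ,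
          (∀ q k k', ω' q k k' = VecActions.d₁ (c q) k k' * ω q k k') ∧
          (∀ k q q', η' k q q' = VecActions.d₁ (fun x => c x k) q q' * η k q q'))) ∧
    -- the symmetry: the same pair, from the other perspective, is an action of `K` on `Vec_Q`
    (∃ E : VecActions.TensorAction₀ (VecActions.VecCat K) Q ≌
        VecActions.TensorAction₀ (VecActions.VecCat Q) K,
      ∀ (T : VecActions.TensorAction₀ (VecActions.VecCat K) Q) (ω η),
        VecActions.IsGivenBy₀ T ω η ↔ VecActions.IsGivenBy₀ (E.functor.obj T) η ω) :=
  ⟨fun φ => ⟨Equiv.ofBijective _ (VecActions.cohomologyClass_bijective φ),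
      VecActions.isGivenBy_iff_cohomologyClass⟩,
    VecActions.exists_isGivenBy₀, VecActions.exists_isGivenBy₀_iff,
    fun _ _ _ _ _ _ => VecActions.nonempty_iso_iff_of_isGivenBy₀,
    VecActions.actionSwap K Q, VecActions.isGivenBy₀_actionSwap_iff⟩
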